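/- **Proposition (infinite-dimensional Berry–Esseen bound for the initial fluctuations).** Let $d\ge 1$, $\mathbb T^d=(\mathbb R/2\pi\mathbb Z)^d$, let $\langle\cdot,\cdot\rangle$ be the $L_2(\mathbb T^d)$ inner product with respect to the normalized Lebesgue measure, $\varsigma_k(x)=e^{\mathrm i k\cdot x}$ for $k\in\mathbb Z^d$, and for $J\ge 0$ let $H_J=\{\varphi\in L_2(\mathbb T^d):\sum_{k}(1+|k|^2)^{J}|\langle\varphi,\varsigma_k\rangle|^2<\infty\}$ and let $H_{-J}$ be the completion of the real space $L_2(\mathbb T^d)$ under the norm $\|f\|_{H_{-J}}^2=\sum_{k}(1+|k|^2)^{-J}|\langle f,\varsigma_k\rangle|^2$; the pairing of $H_{-J}$ and $H_J$ extending the $L_2$ inner product is also denoted by $\langle\cdot,\cdot\rangle$. For $n\ge 1$ let $\mathbb Z_n^d=\{-n,\dots,n\}^d$ and $\mathbb T_n^d=\{\tfrac{2\pi k}{2n+1}:k\in\mathbb Z_n^d\}\subset\mathbb T^d$. For functions on $\mathbb T_n^d$ put $\langle f,g\rangle_n=(2n+1)^{-d}\sum_{x\in\mathbb T_n^d}f(x)\overline{g(x)}$,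 $\|f\|_n=\langle f,f\rangle_n^{1/2}$, and $\mathrm{ex}_nf=\sum_{k\in\mathbb Z_n^d}\langle f,\varsigma_k\rangle_n\,\varsigma_k$, a smooth function on $\mathbb T^d$. For $\rho_n:\mathbb T_n^d\to[0,1]$ let $\nu^n_{\rho_n}$ be the product measure on $\{0,1\}^{\mathbb T_n^d}$ with marginals $\nu^n_{\rho_n}\{\eta(x)=1\}=\rho_n(x)$. For a real Hilbert space $E$, let $\mathcal C^3_{l,HS}(E)$ be the set of three times continuously Fréchet differentiable $F:E\to\mathbb R$ such that $$\|F\|_{\mathcal C^3_{l,HS}}:=\sum_{k=1}^{3}\sup_{x\in E}\|D^kF(x)\|+\sup_{x\in E}\|D^2F(x)\|_{HS}<\infty,$$ where $\|\cdot\|$ is the norm of multilinear forms and $\|A\|_{HS}^2=\sum_{i,j}|A[z_i,z_j]|^2$ for an orthonormal basis $(z_i)$ of $E$. Let $I>\frac d2+1$. Then there is a constant $C_I$, depending only on $I$ and $d$, such that the following holds. Let $\rho\in C^1(\mathbb T^d)$ take values in $[0,1]$, let $\zeta$ be a centered Gaussian random variable in $H_{-I}$ with covariance $$\mathbb E\big[\langle\zeta,\varphi\rangle\langle\zeta,\psi\rangle\big]=\langle\rho(1-\rho)\varphi,\psi\rangle,\qquad\varphi,\psi\in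 H_I,$$ let $n\ge1$, $\rho_n:\mathbb T_n^d\to[0,1]$, let $\eta_n$ have distribution $\nu^n_{\rho_n}$, and put $\zeta_n=(2n+1)^{d/2}(\eta_n-\rho_n)$. Then for every $F\in\mathcal C^3_{l,HS}(H_{-I})$ the random variables $F(\mathrm{ex}_n\zeta_n)$ and $F(\zeta)$ are integrable and $$\big|\mathbb E F(\mathrm{ex}_n\zeta_n)-\mathbb E F(\zeta)\big|\le C_I\Big(\frac1{n^{1\wedge\frac d2}}\big(1+\|\nabla\rho\|_{C}\big)+\|\rho_n-\rho\|_n\Big)\|F\|_{\mathcal C^3_{l,HS}},$$ where $\|\nabla\rho\|_C=\sup_{x\in\mathbb T^d}|\nabla\rho(x)|$ and, in $\|\rho_n-\rho\|_n$, $\rho$ is restricted to $\mathbb T_n^d$. -/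

import Mathlib

open MeasureTheory ProbabilityTheory
open scoped NNReal ENNReal ComplexConjugate

noncomputable section

namespace SSEP

/-! ### The torus and its Fourier basis -/

instance factTwoPiPos : Fact (0 < 2 * Real.pi) := ⟨Real.two_pi_pos⟩

/-- The torus `𝕋^d = (ℝ / 2πℤ)^d`. -/
abbrev Torus (d : ℕ) : Type := Fin d → AddCircle (2 * Real.pi)

/-- The normalized Lebesgue (Haar probability) measure on `𝕋^d`. -/
def torusMeasure (d : ℕ) : Measure (Torus d) :=
  Measure.pi fun _ => AddCircle.haarAddCircle

instance (d : ℕ) : IsProbabilityMeasure (torusMeasure d) := by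
  unfold torusMeasure; infer_instance

/-- The real Hilbert space `L₂(𝕋^d)`. -/
abbrev L2Torus (d : ℕ) : Type := Lp ℝ 2 (torusMeasure d)

/-- The character `ς_k(x) = exp(i k·x)`, `k ∈ ℤ^d`. -/
def char {d : ℕ} (k : Fin d → ℤ) : C(Torus d, ℂ) where
  toFun x := ∏ j, fourier (k j) (x j)
  continuous_toFun := by fun_prop

/-- The Fourier coefficient `⟨f, ς_k⟩ = ∫ f(x) exp(-i k·x) dx` (normalized Lebesgue measure). -/
def coeff {d : ℕ} (f : Torus d → ℝ) (k : Fin d → ℤ) : ℂ :=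
  ∫ x, (f x : ℂ) * conj (char k x) ∂(torusMeasure d)

/-- The weight `1 + |k|²`, with `|k|` the Euclidean norm. -/
def weight {d : ℕ} (k : Fin d → ℤ) : ℝ := 1 + ∑ j, (k j : ℝ) ^ 2

lemma one_le_weight {d : ℕ} (k : Fin d → ℤ) : 1 ≤ weight k := by
  have : 0 ≤ ∑ j, (k j : ℝ) ^ 2 := Finset.sum_nonneg fun j _ => sq_nonneg _
  unfold weight; linarith

lemma weight_pos {d : ℕ} (k : Fin d → ℤ) : 0 < weight k :=
  zero_lt_one.trans_le (one_le_weight k)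

/-! Parseval's identity on `𝕋^d`. -/

lemma char_neg {d : ℕ} (k : Fin d → ℤ) (x : Torus d) : char (-k) x = conj (char k x) := by
  simp only [char, Pi.neg_apply, fourier_neg, ContinuousMap.coe_mk, map_prod]

lemma char_add {d : ℕ} (k l : Fin d → ℤ) (x : Torus d) :
    char (k + l) x = char k x * char l x := by
  simp only [char, Pi.add_apply, fourier_add, ContinuousMap.coe_mk, ← Finset.prod_mul_distrib]

lemma char_zero {d : ℕ} : char (0 : Fin d → ℤ) = 1 := by
  ext x
  simp only [char, Pi.zero_apply, fourier_zero, Finset.prod_const_one, ContinuousMap.coe_mk,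
    ContinuousMap.one_apply]

lemma char_single {d : ℕ} (i : Fin d) (x : Torus d) :
    char (Pi.single i 1) x = fourier 1 (x i) := by
  simp only [char, ContinuousMap.coe_mk]
  rw [Finset.prod_eq_single i]
  · rw [Pi.single_eq_same]
  · intro j _ hj
    rw [Pi.single_eq_of_ne hj, fourier_zero]
  · simp

/-- `ς_k` as an element of the complex `L₂` space. -/
def charLp {d : ℕ} (k : Fin d → ℤ) : Lp ℂ 2 (torusMeasure d) :=
  ContinuousMap.toLp (E := ℂ) 2 (torusMeasure d) ℂ (char k)

lemma span_char_closure (d : ℕ) :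
    (Submodule.span ℂ (Set.range (char (d := d)))).topologicalClosure = ⊤ := by
  let S : StarSubalgebra ℂ C(Torus d, ℂ) :=
    { toSubalgebra := Algebra.adjoin ℂ (Set.range char)
      star_mem' := by
        change Algebra.adjoin ℂ (Set.range char) ≤ star (Algebra.adjoin ℂ (Set.range char))
        refine Algebra.adjoin_le ?_
        rintro _ ⟨n, rfl⟩
        refine Algebra.subset_adjoin ⟨-n, ?_⟩
        ext1 x
        simp only [char_neg, starRingEnd_apply, ContinuousMap.star_apply] }
  have hS : S.toSubalgebra.toSubmodule = Submodule.span ℂ (Set.range (char (d := d))) := by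
    apply Algebra.adjoin_eq_span_of_subset
    refine .trans (fun x ↦ Submonoid.closure_induction (fun _ ↦ id) ⟨0, char_zero⟩ ?_)
      Submodule.subset_span
    rintro _ _ _ _ ⟨m, rfl⟩ ⟨n, rfl⟩
    exact ⟨m + n, ContinuousMap.ext fun x => char_add m n x⟩
  have hsep : S.SeparatesPoints := by
    intro x y hxy
    rw [Ne, funext_iff, not_forall] at hxy
    obtain ⟨i, hi⟩ := hxy
    refine ⟨_, ⟨char (Pi.single i 1), Algebra.subset_adjoin ⟨Pi.single i 1, rfl⟩, rfl⟩, ?_⟩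
    change char (Pi.single i 1) x ≠ char (Pi.single i 1) y
    rw [char_single, char_single, fourier_one, fourier_one]
    contrapose hi
    exact AddCircle.injective_toCircle Real.two_pi_pos.ne' (Circle.ext hi)
  rw [← hS]
  exact congr_arg (Subalgebra.toSubmodule <| StarSubalgebra.toSubalgebra ·)
    (ContinuousMap.starSubalgebra_topologicalClosure_eq_top_of_separatesPoints _ hsep)

lemma orthonormal_charLp (d : ℕ) : Orthonormal ℂ (charLp (d := d)) := by
  rw [orthonormal_iff_ite]
  intro m n
  simp only [charLp, ContinuousMap.inner_toLp, ← char_neg, ← char_add]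
  split_ifs with h
  · simp [h, char_zero]
  simp only [char, ContinuousMap.coe_mk]
  rw [torusMeasure, MeasureTheory.integral_fintype_prod_eq_prod]
  obtain ⟨i, hi⟩ := Function.ne_iff.mp h
  apply Finset.prod_eq_zero (Finset.mem_univ i)
  simpa only [eq_false_intro hi, if_false, ContinuousMap.inner_toLp, ← fourier_neg,
    ← fourier_add] using! (orthonormal_iff_ite.mp <| orthonormal_fourier) (m i) (n i)

/-- The characters form a Hilbert basis of the complex `L₂` space. -/
def charBasis (d : ℕ) : HilbertBasis (Fin d → ℤ) ℂ (Lp ℂ 2 (torusMeasure d)) :=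
  HilbertBasis.mk (orthonormal_charLp d) (by
    have := (ContinuousMap.toLp_denseRange ℂ (torusMeasure d) ℂ
      (p := 2) (by simp)).topologicalClosure_map_submodule (span_char_closure d)
    simp only [Submodule.map_span, ContinuousLinearMap.coe_coe, ← Set.range_comp] at this
    exact this.ge)

lemma coe_charBasis (d : ℕ) : ⇑(charBasis d) = charLp := HilbertBasis.coe_mk _ _

/-- A real `L₂` function regarded as a complex one. -/
def toComplex {d : ℕ} (f : L2Torus d) : Lp ℂ 2 (torusMeasure d) :=
  Complex.ofRealCLM.compLpL 2 (torusMeasure d) f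

lemma toComplex_coeFn {d : ℕ} (f : L2Torus d) :
    toComplex f =ᵐ[torusMeasure d] fun x => ((f x : ℝ) : ℂ) :=
  Complex.ofRealCLM.coeFn_compLp f

lemma inner_charLp {d : ℕ} (f : L2Torus d) (k : Fin d → ℤ) :
    inner ℂ (charLp k) (toComplex f) = coeff f k := by
  rw [MeasureTheory.L2.inner_def, coeff]
  apply integral_congr_ae
  filter_upwards [ContinuousMap.coeFn_toLp (𝕜 := ℂ) (p := 2) (torusMeasure d) (char k),
    toComplex_coeFn f] with x h1 h2
  rw [charLp, h1, h2]
  simp [RCLike.inner_apply]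

/-- **Parseval's identity** `∫ f g = ∑_k ⟨f, ς_k⟩ conj ⟨g, ς_k⟩` for real `f, g ∈ L₂(𝕋^d)`. -/
lemma hasSum_coeff {d : ℕ} (f g : L2Torus d) :
    HasSum (fun k => (coeff f k * conj (coeff g k)).re) (∫ x, f x * g x ∂(torusMeasure d)) := by
  have h := (charBasis d).hasSum_inner_mul_inner (toComplex g) (toComplex f)
  have h2 : inner ℂ (toComplex g) (toComplex f)
      = ((∫ x, f x * g x ∂(torusMeasure d) : ℝ) : ℂ) := by
    rw [MeasureTheory.L2.inner_def, ← integral_complex_ofReal]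
    apply integral_congr_ae
    filter_upwards [toComplex_coeFn f, toComplex_coeFn g] with x h1 h2
    rw [h1, h2]
    simp [RCLike.inner_apply]
  rw [h2] at h
  have h3 := Complex.hasSum_re h
  rw [Complex.ofReal_re] at h3
  refine h3.congr_fun fun k => ?_
  have hk : charBasis d k = charLp k := congrFun (coe_charBasis d) k
  rw [hk, ← inner_conj_symm, inner_charLp, inner_charLp, mul_comm]

lemma summable_norm_sq_coeff {d : ℕ} (f : L2Torus d) :
    Summable fun k => ‖coeff f k‖ ^ 2 := by
  refine (hasSum_coeff f f).summable.congr fun k => ?_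
  rw [Complex.mul_conj, Complex.ofReal_re, Complex.normSq_eq_norm_sq]

lemma coeff_add {d : ℕ} (f g : L2Torus d) (k : Fin d → ℤ) :
    coeff (f + g : L2Torus d) k = coeff f k + coeff g k := by
  rw [← inner_charLp, ← inner_charLp, ← inner_charLp, ← inner_add_right, toComplex, map_add]
  rfl

lemma coeff_smul {d : ℕ} (c : ℝ) (f : L2Torus d) (k : Fin d → ℤ) :
    coeff (c • f : L2Torus d) k = c * coeff f k := by
  have h : toComplex (c • f) = c • toComplex f := by
    rw [toComplex, map_smul]; rfl
  rw [← inner_charLp, ← inner_charLp, h, inner_smul_right_eq_smul, Complex.real_smul]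

/-! ### The Sobolev spaces `H_J` and `H_{-J}`, `J ≥ 0` -/

lemma summable_weight_mul {d : ℕ} (J : ℝ≥0) (f g : L2Torus d) :
    Summable fun k : Fin d → ℤ => weight k ^ (-(J : ℝ)) * (coeff f k * conj (coeff g k)).re := by
  refine Summable.of_norm_bounded
    ((summable_norm_sq_coeff f).add (summable_norm_sq_coeff g)) fun k => ?_
  have h1 : weight k ^ (-(J : ℝ)) ≤ 1 :=
    Real.rpow_le_one_of_one_le_of_nonpos (one_le_weight k) (by simp)
  have h0 : 0 ≤ weight k ^ (-(J : ℝ)) := Real.rpow_nonneg (weight_pos k).le _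
  have h2 : |(coeff f k * conj (coeff g k)).re| ≤ ‖coeff f k‖ * ‖coeff g k‖ := by
    refine (Complex.abs_re_le_norm _).trans ?_
    rw [norm_mul, RCLike.norm_conj]
  rw [Real.norm_eq_abs, abs_mul, abs_of_nonneg h0]
  nlinarith [abs_nonneg (coeff f k * conj (coeff g k)).re,
    mul_le_mul_of_nonneg_right h1 (abs_nonneg (coeff f k * conj (coeff g k)).re),
    sq_nonneg (‖coeff f k‖ - ‖coeff g k‖), sq_nonneg (‖coeff f k‖), sq_nonneg (‖coeff g k‖)]

/-- `L₂(𝕋^d)`, to be equipped with the (weaker) `H_{-J}` norm. -/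
def PreNegSobolev (d : ℕ) (_J : ℝ≥0) : Type := L2Torus d

instance (d : ℕ) (J : ℝ≥0) : AddCommGroup (PreNegSobolev d J) :=
  inferInstanceAs (AddCommGroup (L2Torus d))

instance (d : ℕ) (J : ℝ≥0) : Module ℝ (PreNegSobolev d J) :=
  inferInstanceAs (Module ℝ (L2Torus d))

/-- The identity map from `L₂(𝕋^d)` to its copy carrying the `H_{-J}` norm. -/
def toPre {d : ℕ} (J : ℝ≥0) : L2Torus d ≃ₗ[ℝ] PreNegSobolev d J := LinearEquiv.refl ℝ (L2Torus d)

/-- The inner product `⟨f, g⟩_{H_{-J}} = ∑_k (1 + |k|²)^{-J} ⟨f, ς_k⟩ conj ⟨g, ς_k⟩` on `L₂(𝕋^d)`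
(each summand is replaced by its real part; the imaginary parts at `k` and `-k` cancel). -/
@[reducible] def negCore (d : ℕ) (J : ℝ≥0) : PreInnerProductSpace.Core ℝ (PreNegSobolev d J) where
  inner f g := ∑' k : Fin d → ℤ, weight k ^ (-(J : ℝ)) *
    (coeff ((toPre J).symm f) k * conj (coeff ((toPre J).symm g) k)).re
  conj_inner_symm f g := by
    simp only [conj_trivial]
    refine tsum_congr fun k => ?_
    simp only [Complex.mul_re, Complex.conj_re, Complex.conj_im]
    ring
  re_inner_nonneg f := by
    refine tsum_nonneg fun k => mul_nonneg (Real.rpow_nonneg (weight_pos k).le _) ?_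
    rw [Complex.mul_conj, Complex.ofReal_re]
    exact Complex.normSq_nonneg _
  add_left f g h := by
    rw [← (summable_weight_mul J _ _).tsum_add (summable_weight_mul J _ _)]
    refine tsum_congr fun k => ?_
    rw [map_add, coeff_add, add_mul, Complex.add_re, mul_add]
  smul_left f g r := by
    rw [conj_trivial, ← tsum_mul_left]
    refine tsum_congr fun k => ?_
    rw [map_smul, coeff_smul, mul_assoc, Complex.re_ofReal_mul]
    ring

instance (d : ℕ) (J : ℝ≥0) : SeminormedAddCommGroup (PreNegSobolev d J) :=
  @InnerProductSpace.Core.toSeminormedAddCommGroup ℝ (PreNegSobolev d J) _ _ _ (negCore d J)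

instance (d : ℕ) (J : ℝ≥0) : InnerProductSpace ℝ (PreNegSobolev d J) :=
  InnerProductSpace.ofCore (negCore d J)

/-- The Sobolev space `H_{-J}(𝕋^d)`: the completion of `L₂(𝕋^d)` with respect to the norm
`‖f‖²_{H_{-J}} = ∑_k (1 + |k|²)^{-J} |⟨f, ς_k⟩|²`. It is a real Hilbert space. -/
abbrev NegSobolev (d : ℕ) (J : ℝ≥0) : Type := UniformSpace.Completion (PreNegSobolev d J)

instance (d : ℕ) (J : ℝ≥0) : MeasurableSpace (NegSobolev d J) := borel _

instance (d : ℕ) (J : ℝ≥0) : BorelSpace (NegSobolev d J) := ⟨rfl⟩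

/-- The dense embedding `L₂(𝕋^d) ⊂ H_{-J}`. -/
def toNeg {d : ℕ} (J : ℝ≥0) : L2Torus d →ₗ[ℝ] NegSobolev d J :=
  (UniformSpace.Completion.toComplL (𝕜 := ℝ) (E := PreNegSobolev d J)).toLinearMap ∘ₗ
    (toPre J).toLinearMap

lemma denseRange_toNeg (d : ℕ) (J : ℝ≥0) : DenseRange (toNeg (d := d) J) :=
  (UniformSpace.Completion.denseRange_coe (α := PreNegSobolev d J)).comp
    (toPre J).surjective.denseRange (UniformSpace.Completion.continuous_coe _)

lemma norm_sq_toNeg {d : ℕ} (J : ℝ≥0) (f : L2Torus d) :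
    ‖toNeg J f‖ ^ 2 = ∑' k : Fin d → ℤ, weight k ^ (-(J : ℝ)) * ‖coeff f k‖ ^ 2 := by
  change ‖((toPre J f : PreNegSobolev d J) : NegSobolev d J)‖ ^ 2 = _
  rw [UniformSpace.Completion.norm_coe, ← real_inner_self_eq_norm_sq]
  refine tsum_congr fun k => ?_
  rw [LinearEquiv.symm_apply_apply, Complex.mul_conj, Complex.ofReal_re,
    Complex.normSq_eq_norm_sq]

/-- `φ ∈ H_J`, i.e. `φ ∈ L₂(𝕋^d)` and `∑_k (1 + |k|²)^J |⟨φ, ς_k⟩|² < ∞`. -/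
def MemSobolev {d : ℕ} (J : ℝ≥0) (φ : L2Torus d) : Prop :=
  Summable fun k : Fin d → ℤ => weight k ^ (J : ℝ) * ‖coeff φ k‖ ^ 2

/-- The linear functional `f ↦ ⟨f, φ⟩ = ∫ f φ` on `L₂(𝕋^d)`. -/
def l2Pairing {d : ℕ} (φ : L2Torus d) : L2Torus d →ₗ[ℝ] ℝ := (innerSL ℝ φ).toLinearMap

lemma l2Pairing_apply {d : ℕ} (φ f : L2Torus d) :
    l2Pairing φ f = ∫ x, f x * φ x ∂(torusMeasure d) := by
  change inner ℝ φ f = _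
  rw [MeasureTheory.L2.inner_def]
  exact integral_congr_ae (.of_forall fun x => by simp [RCLike.inner_apply])

/-- The duality pairing `⟨ζ, φ⟩` of `ζ ∈ H_{-J}` with `φ ∈ H_J`: the continuous extension to
`H_{-J}` of the functional `f ↦ ∫ f φ` on `L₂(𝕋^d)`. -/
def pairing {d : ℕ} (J : ℝ≥0) (φ : L2Torus d) : NegSobolev d J →L[ℝ] ℝ :=
  (l2Pairing φ).extendOfNorm (toNeg J)

/-- For `φ ∈ H_J` the functional `f ↦ ∫ f φ` is indeed continuous in the `H_{-J}` norm. -/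
lemma l2Pairing_bound {d : ℕ} {J : ℝ≥0} {φ : L2Torus d} (hφ : MemSobolev J φ) (f : L2Torus d) :
    ‖l2Pairing φ f‖ ≤
      √(∑' k : Fin d → ℤ, weight k ^ (J : ℝ) * ‖coeff φ k‖ ^ 2) * ‖toNeg J f‖ := by
  have hsf : Summable fun k : Fin d → ℤ => weight k ^ (-(J : ℝ)) * ‖coeff f k‖ ^ 2 :=
    (summable_weight_mul J f f).congr fun k => by
      rw [Complex.mul_conj, Complex.ofReal_re, Complex.normSq_eq_norm_sq]
  have e1 : ∀ k : Fin d → ℤ, (weight k ^ ((J : ℝ) / 2) * ‖coeff φ k‖) ^ (2 : ℝ)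
      = weight k ^ (J : ℝ) * ‖coeff φ k‖ ^ 2 := fun k => by
    rw [Real.rpow_two, mul_pow, ← Real.rpow_mul_natCast (weight_pos k).le]
    norm_num
  have e2 : ∀ k : Fin d → ℤ, (weight k ^ (-(J : ℝ) / 2) * ‖coeff f k‖) ^ (2 : ℝ)
      = weight k ^ (-(J : ℝ)) * ‖coeff f k‖ ^ 2 := fun k => by
    rw [Real.rpow_two, mul_pow, ← Real.rpow_mul_natCast (weight_pos k).le]
    norm_num
  have e3 : ∀ k : Fin d → ℤ, (weight k ^ ((J : ℝ) / 2) * ‖coeff φ k‖) *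
      (weight k ^ (-(J : ℝ) / 2) * ‖coeff f k‖) = ‖coeff f k‖ * ‖coeff φ k‖ := fun k => by
    have : weight k ^ ((J : ℝ) / 2) * weight k ^ (-(J : ℝ) / 2) = 1 := by
      rw [← Real.rpow_add (weight_pos k), neg_div, add_neg_cancel, Real.rpow_zero]
    linear_combination (‖coeff f k‖ * ‖coeff φ k‖) * this
  have key := Real.summable_and_inner_le_Lp_mul_Lq_tsum_of_nonneg Real.HolderConjugate.two_two
    (f := fun k : Fin d → ℤ => weight k ^ ((J : ℝ) / 2) * ‖coeff φ k‖)
    (g := fun k : Fin d → ℤ => weight k ^ (-(J : ℝ) / 2) * ‖coeff f k‖)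
    (fun k => mul_nonneg (Real.rpow_nonneg (weight_pos k).le _) (norm_nonneg _))
    (fun k => mul_nonneg (Real.rpow_nonneg (weight_pos k).le _) (norm_nonneg _))
    (by simp only [e1]; exact hφ) (by simp only [e2]; exact hsf)
  simp only [e1, e2, e3] at key
  rw [← norm_sq_toNeg, ← Real.sqrt_eq_rpow, ← Real.sqrt_eq_rpow,
    Real.sqrt_sq (norm_nonneg _)] at key
  refine le_trans ?_ key.2
  rw [l2Pairing_apply, ← (hasSum_coeff f φ).tsum_eq]
  refine tsum_of_norm_bounded key.1.hasSum fun k => ?_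
  refine (Complex.abs_re_le_norm _).trans ?_
  rw [norm_mul, RCLike.norm_conj]

lemma pairing_toNeg {d : ℕ} {J : ℝ≥0} {φ : L2Torus d} (hφ : MemSobolev J φ) (f : L2Torus d) :
    pairing J φ (toNeg J f) = ∫ x, f x * φ x ∂(torusMeasure d) := by
  rw [← l2Pairing_apply]
  exact LinearMap.extendOfNorm_eq (denseRange_toNeg d J) ⟨_, l2Pairing_bound hφ⟩ f

/-! ### Hilbert-Schmidt forms and the class `C^m_{l,HS}` -/

section HilbertSchmidt

variable (E : Type*) [NormedAddCommGroup E] [InnerProductSpace ℝ E] [CompleteSpace E]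

/-- Index set of a chosen orthonormal basis of the Hilbert space `E`. -/
def onbIndex : Set E := (exists_hilbertBasis ℝ E).choose

/-- A chosen orthonormal basis of the Hilbert space `E`. -/
def onb : HilbertBasis (onbIndex E) ℝ E := (exists_hilbertBasis ℝ E).choose_spec.choose

variable {E}

/-- The Hilbert-Schmidt norm `(∑_{i,j} |A[z_i, z_j]|²)^{1/2} ∈ [0, ∞]` of a continuous bilinear form,
computed in an orthonormal basis; it does not depend on the basis, see `hsENorm_eq`. -/
def hsENorm (A : E [×2]→L[ℝ] ℝ) : ℝ≥0∞ :=
  (∑' (i : onbIndex E) (j : onbIndex E), ‖A ![onb E i, onb E j]‖ₑ ^ 2) ^ (1 / 2 : ℝ)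

lemma tsum_enorm_sq_dual {ι : Type*} (b : HilbertBasis ι ℝ E) (L : E →L[ℝ] ℝ) :
    ∑' i, ‖L (b i)‖ₑ ^ 2 = ENNReal.ofReal (‖L‖ ^ 2) := by
  obtain ⟨v, rfl⟩ := (InnerProductSpace.toDual ℝ E).surjective L
  have hs := b.hasSum_inner_mul_inner v v
  have e : ∀ i, inner ℝ v (b i) * inner ℝ (b i) v = ‖inner ℝ v (b i)‖ ^ 2 := fun i => by
    rw [real_inner_comm v (b i), ← sq, Real.norm_eq_abs, sq_abs]
  simp only [e] at hs
  rw [LinearIsometryEquiv.norm_map, ← real_inner_self_eq_norm_sq, ← hs.tsum_eq,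
    ENNReal.ofReal_tsum_of_nonneg (fun i => sq_nonneg _) hs.summable]
  refine tsum_congr fun i => ?_
  rw [ENNReal.ofReal_pow (norm_nonneg _), ofReal_norm, InnerProductSpace.toDual_apply_apply]

lemma hsENorm_eq (A : E [×2]→L[ℝ] ℝ) {ι : Type*} (b : HilbertBasis ι ℝ E) :
    hsENorm A = (∑' (i : ι) (j : ι), ‖A ![b i, b j]‖ₑ ^ 2) ^ (1 / 2 : ℝ) := by
  have hl : ∀ (y : E), ∃ L : E →L[ℝ] ℝ, ∀ x, L x = A ![y, x] := fun y =>
    ⟨A.toContinuousLinearMap ![y, 0] 1, fun x => by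
      change A (Function.update ![y, 0] 1 x) = A ![y, x]
      congr 1; ext i; fin_cases i <;> simp⟩
  have hr : ∀ (y : E), ∃ L : E →L[ℝ] ℝ, ∀ x, L x = A ![x, y] := fun y =>
    ⟨A.toContinuousLinearMap ![0, y] 0, fun x => by
      change A (Function.update ![0, y] 0 x) = A ![x, y]
      congr 1; ext i; fin_cases i <;> simp⟩
  have h1 : ∀ (y : E), ∑' j : onbIndex E, ‖A ![y, onb E j]‖ₑ ^ 2 = ∑' j, ‖A ![y, b j]‖ₑ ^ 2 := by
    intro y
    obtain ⟨L, hL⟩ := hl y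
    simp only [← hL]
    rw [tsum_enorm_sq_dual, tsum_enorm_sq_dual]
  have h2 : ∀ (y : E), ∑' j : onbIndex E, ‖A ![onb E j, y]‖ₑ ^ 2 = ∑' j, ‖A ![b j, y]‖ₑ ^ 2 := by
    intro y
    obtain ⟨L, hL⟩ := hr y
    simp only [← hL]
    rw [tsum_enorm_sq_dual, tsum_enorm_sq_dual]
  rw [hsENorm]
  congr 1
  simp only [h1]
  rw [ENNReal.tsum_comm]
  simp only [h2]
  rw [ENNReal.tsum_comm]

/-- `‖F‖_{C^m_{l,HS}} = ∑_{k=1}^m sup_x ‖D^k F(x)‖ + sup_x ‖D² F(x)‖_{HS}`, as an element of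
`[0, ∞]`. -/
def clHSENorm (m : ℕ) (F : E → ℝ) : ℝ≥0∞ :=
  ∑ k ∈ Finset.Icc 1 m, (⨆ x, ‖iteratedFDeriv ℝ k F x‖ₑ) +
    ⨆ x, hsENorm (iteratedFDeriv ℝ 2 F x)

/-- `F ∈ C^m_{l,HS}(E)`, `m ≥ 2`: `F` is `m` times continuously Fréchet differentiable, the
derivatives `DF, …, D^m F` are bounded, and `D² F` is bounded in the Hilbert-Schmidt norm.
(`F` itself need not be bounded.) -/
def MemClHS (m : ℕ) (F : E → ℝ) : Prop :=
  ContDiff ℝ m F ∧ clHSENorm m F < ∞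

/-- The seminorm `‖F‖_{C^m_{l,HS}}` of `F ∈ C^m_{l,HS}(E)` as a real number. -/
def clHSNorm (m : ℕ) (F : E → ℝ) : ℝ := (clHSENorm m F).toReal

end HilbertSchmidt

/-! ### The discrete torus and the extension operator -/

/-- `ℤ_n^d = {-n, …, n}^d`. It indexes both the points of the discrete torus and the discrete
frequencies; functions on `𝕋_n^d` are written as functions of the index. -/
abbrev Idx (d n : ℕ) : Type := Fin d → Finset.Icc (-(n : ℤ)) (n : ℤ)

/-- The integer vector underlying an index. -/
def freq {d n : ℕ} (k : Idx d n) : Fin d → ℤ := fun j => (k j : ℤ)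

/-- The point `2π x / (2n+1)` of `𝕋_n^d ⊂ 𝕋^d` with index `x`. -/
def site {d n : ℕ} (x : Idx d n) : Torus d :=
  fun j => ((2 * Real.pi * (freq x j : ℝ) / (2 * n + 1) : ℝ) : AddCircle (2 * Real.pi))

/-- The discrete norm `‖f‖_n = ((2n+1)^{-d} ∑_x f(x)²)^{1/2}`. -/
def discNorm {d n : ℕ} (f : Idx d n → ℝ) : ℝ :=
  √(((2 * n + 1 : ℝ) ^ d)⁻¹ * ∑ x, f x ^ 2)

/-- The discrete Fourier coefficient
`⟨f, ς_k⟩_n = (2n+1)^{-d} ∑_{x ∈ 𝕋_n^d} f(x) conj (ς_k(x))`. -/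
def discCoeff {d n : ℕ} (f : Idx d n → ℝ) (k : Idx d n) : ℂ :=
  ((2 * n + 1 : ℂ) ^ d)⁻¹ * ∑ x, (f x : ℂ) * conj (char (freq k) (site x))

/-- The extension operator `ex_n f(x) = ∑_{k ∈ ℤ_n^d} ⟨f, ς_k⟩_n ς_k(x)`, `x ∈ 𝕋^d`. The sum is real
because the terms with `k` and `-k` are conjugate. -/
def ex {d n : ℕ} (f : Idx d n → ℝ) : C(Torus d, ℝ) where
  toFun x := (∑ k, discCoeff f k * char (freq k) x).re
  continuous_toFun := by fun_prop

/-- `ex_n f` as an element of `H_{-J}`. -/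
def exNeg {d n : ℕ} (J : ℝ≥0) (f : Idx d n → ℝ) : NegSobolev d J :=
  toNeg J (ContinuousMap.toLp (E := ℝ) 2 (torusMeasure d) ℝ (ex f))

/-! ### Initial particle configurations and their fluctuations -/

/-- The product measure `ν^n_ρ` on `{0,1}^{𝕋_n^d}` with `ν^n_ρ{η(x) = 1} = ρ(x)`. -/
def productBernoulli {d n : ℕ} (ρ : Idx d n → unitInterval) : Measure (Idx d n → Bool) :=
  Measure.pi fun x => bernoulliMeasure true false (ρ x)

/-- The fluctuation field `(2n+1)^{d/2} (η(x) - ρ(x))`. -/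
def fluctuation {d n : ℕ} (ρ : Idx d n → unitInterval) (η : Idx d n → Bool) : Idx d n → ℝ :=
  fun x => (2 * n + 1 : ℝ) ^ ((d : ℝ) / 2) * ((if η x then 1 else 0) - (ρ x : ℝ))

/-! ### The limiting Gaussian variable -/

/-- The `2πℤ^d`-periodic function on `ℝ^d` corresponding to a function on `𝕋^d`. -/
def lift {d : ℕ} (ρ : Torus d → ℝ) : EuclideanSpace ℝ (Fin d) → ℝ :=
  fun y => ρ fun j => ((y j : ℝ) : AddCircle (2 * Real.pi))

/-- `ρ ∈ C¹(𝕋^d)`. -/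
def IsC1 {d : ℕ} (ρ : Torus d → ℝ) : Prop := ContDiff ℝ 1 (lift ρ)

/-- `‖∇ρ‖_C = sup_x |∇ρ(x)|`. -/
def gradNorm {d : ℕ} (ρ : Torus d → ℝ) : ℝ := ⨆ y, ‖gradient (lift ρ) y‖

/-- The covariance form `A_ρ[φ, ψ] = ⟨ρ(1-ρ)φ, ψ⟩`. -/
def covForm {d : ℕ} (ρ : Torus d → ℝ) (φ ψ : L2Torus d) : ℝ :=
  ∫ x, ρ x * (1 - ρ x) * φ x * ψ x ∂(torusMeasure d)

/-- `ζ` is a centered Gaussian random variable in `H_{-J}` with covariance `A_ρ`: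
`E[⟨ζ, φ⟩⟨ζ, ψ⟩] = A_ρ[φ, ψ]` for all `φ, ψ ∈ H_J`. -/
structure IsCenteredGaussian {d : ℕ} {J : ℝ≥0} {Ω : Type*} [MeasurableSpace Ω]
    (ζ : Ω → NegSobolev d J) (ρ : Torus d → ℝ) (P : Measure Ω) : Prop where
  gaussian : HasGaussianLaw ζ P
  centered : ∫ ω, ζ ω ∂P = 0
  covariance : ∀ φ ψ : L2Torus d, MemSobolev J φ → MemSobolev J ψ →
    ∫ ω, pairing J φ (ζ ω) * pairing J ψ (ζ ω) ∂P = covForm ρ φ ψ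

end SSEP

end

noncomputable section

namespace SSEP

/-! ### Comparing laws through translates of a test function -/

section TranslateClose

variable {E : Type*} [NormedAddCommGroup E] [MeasurableSpace E]

/-! The extended field is a sum `∑ x, Z_x • v_x` in the Hilbert space H_{-I}: the `Z_x` are
independent centered occupation variables with |Z_x| ≤ 1, and the fixed vectors `v_x = siteVec I x`
have norm of order N^{-1/2}, where N = (2n+1)^d. The law of this sum reaches that of ζ in two
exchanges.

Lindeberg exchange: each `Z_x • v_x` is replaced by a Gaussian multiple of `v_x` with the same
variance. The Taylor terms of order at most two agree, so the cost is a constant times ∑ ‖v_x‖³, of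
order N · N^{-3/2} = N^{-1/2}, hence at most of order n^{-d/2}. The bound on ‖v_x‖ uses ∑
(1+|k|²)^{-I} < ∞.

Gaussian exchange (`TranslateClose.of_isGaussian`): two centered Gaussian laws with different
covariances are each split into M independent copies scaled by M^{-1/2}, and the copies are
exchanged one by one. The third order cost is O(M^{-1/2}) in total and disappears as M → ∞. What
remains is half the difference of the integrals of D²F(y)[x, x], which is at most the
Hilbert-Schmidt norm of D²F times that of the covariance difference (`abs_integral_bilin_sub_le`).

The covariances are compared in the basis (1+|k|²)^{I/2} cas(k·x) (`abs_covariance_sub_le`). The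
entries are Riemann sums against integrals of ρ(1-ρ) cas(k·x) cas(l·x); the mesh error costs one
derivative, that is, a factor √weight(k) √weight(l) or a gradient of ρ. The difference is therefore
dominated by a rank one kernel a_k a_l with ∑ a_k² proportional to ∑ (1+|k|²)^{-(I-1)}, which is
finite exactly because I - 1 > d/2.

All comparisons are uniform over translates of F. This makes them stable under adding an independent
summand, so the errors of successive exchanges add up (`TranslateClose.sum`). -/

/-- `|∫ F(y + x) dμ(x) - ∫ F(y + x) dν(x)| ≤ ε` for all `y`. -/
def TranslateClose (F : E → ℝ) (μ ν : Measure E) (ε : ℝ) : Prop :=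
  ∀ y, |∫ x, F (y + x) ∂μ - ∫ x, F (y + x) ∂ν| ≤ ε

lemma TranslateClose.trans {F : E → ℝ} {μ ν κ : Measure E} {ε δ : ℝ}
    (h : TranslateClose F μ ν ε) (h' : TranslateClose F ν κ δ) : TranslateClose F μ κ (ε + δ) :=
  fun y => (abs_sub_le _ _ _).trans (add_le_add (h y) (h' y))

variable [BorelSpace E] [SecondCountableTopology E]

omit [SecondCountableTopology E] in
lemma integrable_comp_add {K : ℝ≥0} {F : E → ℝ} (hF : LipschitzWith K F) {μ : Measure E}
    [IsFiniteMeasure μ] (hμ : Integrable id μ) (y : E) : Integrable (fun x => F (y + x)) μ := by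
  refine Integrable.mono' ((integrable_const |F y|).add (hμ.norm.const_mul (K : ℝ)))
    (hF.continuous.comp (continuous_const.add continuous_id)).aestronglyMeasurable
    (.of_forall fun x => ?_)
  have h := hF.dist_le_mul (y + x) y
  rw [Real.dist_eq, dist_self_add_left] at h
  have h2 := abs_sub_abs_le_abs_sub (F (y + x)) (F y)
  simp only [Real.norm_eq_abs, Pi.add_apply, id]
  linarith

lemma integrable_id_conv {μ ν : Measure E} [IsFiniteMeasure μ] [IsFiniteMeasure ν]
    (hμ : Integrable id μ) (hν : Integrable id ν) : Integrable id (μ ∗ ν) := by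
  rw [Measure.conv, integrable_map_measure aestronglyMeasurable_id (by fun_prop)]
  exact (hμ.comp_fst ν).add (hν.comp_snd μ)

lemma integral_comp_add_conv {K : ℝ≥0} {F : E → ℝ} (hF : LipschitzWith K F) {μ ν : Measure E}
    [IsFiniteMeasure μ] [IsFiniteMeasure ν] (hμ : Integrable id μ) (hν : Integrable id ν) (y : E) :
    ∫ x, F (y + x) ∂(μ ∗ ν) = ∫ x, ∫ x', F ((y + x) + x') ∂ν ∂μ := by
  rw [integral_conv (integrable_comp_add hF (integrable_id_conv hμ hν) y)]
  simp only [add_assoc]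

/-- The common independent summand only acts as a random translation, over which the hypothesis is
uniform; by Fubini the error is averaged against a probability measure. -/
lemma TranslateClose.conv_left {K : ℝ≥0} {F : E → ℝ} (hF : LipschitzWith K F)
    {κ μ ν : Measure E} [IsProbabilityMeasure κ] [IsFiniteMeasure μ] [IsFiniteMeasure ν]
    (hκ : Integrable id κ) (hμ : Integrable id μ) (hν : Integrable id ν) {ε : ℝ}
    (h : TranslateClose F μ ν ε) : TranslateClose F (κ ∗ μ) (κ ∗ ν) ε := by
  have key : ∀ (τ : Measure E) [IsFiniteMeasure τ], Integrable id τ → ∀ y,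
      Integrable (fun x => ∫ x', F ((y + x) + x') ∂τ) κ := fun τ _ hτ y => by
    have h1 := integrable_comp_add hF (integrable_id_conv hκ hτ) y
    have hc : Continuous fun x => F (y + x) := hF.continuous.comp (by fun_prop)
    rw [Measure.conv, integrable_map_measure hc.aestronglyMeasurable (by fun_prop)] at h1
    simpa only [Function.comp_def, add_assoc] using h1.integral_prod_left
  intro y
  rw [integral_comp_add_conv hF hκ hμ, integral_comp_add_conv hF hκ hν,
    ← integral_sub (key μ hμ y) (key ν hν y)]
  refine (norm_integral_le_of_norm_le_const (μ := κ) (C := ε)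
    (f := fun x => ∫ x', F ((y + x) + x') ∂μ - ∫ x', F ((y + x) + x') ∂ν)
    (.of_forall fun x => h (y + x))).trans ?_
  simp

/-- One exchange at a time, through the mixed law `μ' ∗ ν`. Commutativity of convolution brings the
shared factor to the left in each half. -/
lemma TranslateClose.conv {K : ℝ≥0} {F : E → ℝ} (hF : LipschitzWith K F)
    {μ ν μ' ν' : Measure E} [IsProbabilityMeasure μ] [IsProbabilityMeasure ν]
    [IsProbabilityMeasure μ'] [IsProbabilityMeasure ν'] (hμ : Integrable id μ)
    (hν : Integrable id ν) (hμ' : Integrable id μ') (hν' : Integrable id ν') {ε ε' : ℝ}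
    (h : TranslateClose F μ ν ε) (h' : TranslateClose F μ' ν' ε') :
    TranslateClose F (μ ∗ μ') (ν ∗ ν') (ε + ε') := by
  refine TranslateClose.trans (ν := μ' ∗ ν) ?_ ?_
  · rw [Measure.conv_comm μ μ']
    exact h.conv_left hF hμ' hμ hν
  · rw [Measure.conv_comm μ' ν]
    exact h'.conv_left hF hν hμ' hν'

omit [BorelSpace E] [SecondCountableTopology E] in
lemma map_zero_eq_dirac {Ω : Type*} [MeasurableSpace Ω] (P : Measure Ω) [IsProbabilityMeasure P] :
    P.map (0 : Ω → E) = Measure.dirac 0 := by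
  rw [show (0 : Ω → E) = fun _ => (0 : E) from rfl, Measure.map_const]
  simp

lemma integrable_id_map {Ω : Type*} [MeasurableSpace Ω] {P : Measure Ω} {X : Ω → E}
    (hX : Measurable X) (hi : Integrable X P) : Integrable id (P.map X) := by
  rw [integrable_map_measure aestronglyMeasurable_id hX.aemeasurable]
  exact hi

/-- Lindeberg's replacement scheme: independence turns partial sums into convolutions, so exchanging
the summands one after another adds the individual errors. -/
lemma TranslateClose.sum {K : ℝ≥0} {F : E → ℝ} (hF : LipschitzWith K F) {ι Ω Ω' : Type*}
    [MeasurableSpace Ω] [MeasurableSpace Ω'] {P : Measure Ω} {P' : Measure Ω'}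
    [IsProbabilityMeasure P] [IsProbabilityMeasure P'] {X : ι → Ω → E} {X' : ι → Ω' → E}
    (hX : iIndepFun X P) (hX' : iIndepFun X' P') (hm : ∀ i, Measurable (X i))
    (hm' : ∀ i, Measurable (X' i)) (hi : ∀ i, Integrable (X i) P)
    (hi' : ∀ i, Integrable (X' i) P') {ε : ι → ℝ}
    (h : ∀ i, TranslateClose F (P.map (X i)) (P'.map (X' i)) (ε i)) (s : Finset ι) :
    TranslateClose F (P.map (∑ i ∈ s, X i)) (P'.map (∑ i ∈ s, X' i)) (∑ i ∈ s, ε i) := by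
  classical
  induction s using Finset.induction with
  | empty =>
    intro y
    rw [Finset.sum_empty, Finset.sum_empty, map_zero_eq_dirac, map_zero_eq_dirac]
    simp
  | insert i s his ih =>
    have := Measure.isProbabilityMeasure_map (μ := P) (hm i).aemeasurable
    have := Measure.isProbabilityMeasure_map (μ := P') (hm' i).aemeasurable
    have hs : Measurable (∑ j ∈ s, X j) := by fun_prop
    have hs' : Measurable (∑ j ∈ s, X' j) := by fun_prop
    have := Measure.isProbabilityMeasure_map (μ := P) hs.aemeasurable
    have := Measure.isProbabilityMeasure_map (μ := P') hs'.aemeasurable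
    rw [Finset.sum_insert his, Finset.sum_insert his, Finset.sum_insert his, add_comm (X i),
      add_comm (X' i), add_comm (ε i),
      (hX.indepFun_finsetSum_of_notMem hm his).map_add_eq_map_conv_map hs (hm i),
      (hX'.indepFun_finsetSum_of_notMem hm' his).map_add_eq_map_conv_map hs' (hm' i)]
    exact TranslateClose.conv hF (integrable_id_map hs (integrable_finsetSum' s fun j _ => hi j))
      (integrable_id_map hs' (integrable_finsetSum' s fun j _ => hi' j))
      (integrable_id_map (hm i) (hi i)) (integrable_id_map (hm' i) (hi' i)) ih (h i)

end TranslateClose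

/-! ### Third order Taylor expansion and exchange of laws -/

section Taylor

variable {E : Type*} [NormedAddCommGroup E] [NormedSpace ℝ E]

/-- The remainder in integral form is ½ ∫ (1-t)² D³F(y+tx)[x,x,x] dt. Bounding (1-t)² by 1 gives the
constant K/2 instead of the sharp K/6. -/
lemma abs_taylor_two_remainder_le {F : E → ℝ} {K : ℝ} (hF : ContDiff ℝ 3 F)
    (hK : ∀ x, ‖iteratedFDeriv ℝ 3 F x‖ ≤ K) (y x : E) :
    |F (y + x) - (F y + fderiv ℝ F y x + 2⁻¹ * iteratedFDeriv ℝ 2 F y fun _ => x)|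
      ≤ K / 2 * ‖x‖ ^ 3 := by
  have h := map_add_eq_sum_add_integral_iteratedFDeriv (f := F) (x := y) (y := x) (n := 2)
    fun t _ => by norm_num; exact hF.contDiffAt
  simp only [Finset.sum_range_succ, Finset.sum_range_zero, iteratedFDeriv_zero_apply,
    iteratedFDeriv_one_apply, Nat.factorial] at h
  norm_num at h
  have hb : ‖∫ t in (0 : ℝ)..1, (1 - t) ^ 2 * iteratedFDeriv ℝ 3 F (y + t • x) fun _ => x‖
      ≤ K * ‖x‖ ^ 3 * |1 - 0| := by
    refine intervalIntegral.norm_integral_le_of_norm_le_const fun t ht => ?_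
    rw [Set.uIoc_of_le zero_le_one] at ht
    have h1 : ‖(1 - t) ^ 2‖ ≤ 1 := by
      rw [Real.norm_eq_abs, abs_of_nonneg (sq_nonneg _)]
      nlinarith [ht.1, ht.2]
    have h2 : ‖iteratedFDeriv ℝ 3 F (y + t • x) fun _ => x‖ ≤ K * ‖x‖ ^ 3 := by
      refine (ContinuousMultilinearMap.le_opNorm _ _).trans ?_
      simp only [Finset.prod_const, Finset.card_univ, Fintype.card_fin]
      gcongr
      exact hK _
    rw [norm_mul]
    calc _ ≤ 1 * (K * ‖x‖ ^ 3) := by gcongr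
      _ = _ := one_mul _
  rw [h]
  rw [Real.norm_eq_abs, sub_zero, abs_one, mul_one] at hb
  have e : ∀ a b c : ℝ, a + 1 / 2 * b + c - (a + 2⁻¹ * b) = c := fun a b c => by ring
  rw [e, abs_mul, abs_of_pos (by norm_num : (0:ℝ) < 1 / 2)]
  linarith

lemma continuous_bilin_diag (B : E [×2]→L[ℝ] ℝ) : Continuous fun x => B fun _ => x :=
  B.cont.comp (continuous_pi fun _ => continuous_id)

variable [MeasurableSpace E]

omit [NormedSpace ℝ E] in
lemma integrable_id_of_memLp_three {μ : Measure E} [IsFiniteMeasure μ] (hμ : MemLp id 3 μ) :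
    Integrable id μ :=
  hμ.integrable (by norm_num)

variable [BorelSpace E]

lemma integrable_bilin_diag (B : E [×2]→L[ℝ] ℝ) {μ : Measure E} (hμ : MemLp id 2 μ) :
    Integrable (fun x => B fun _ => x) μ := by
  refine ((hμ.integrable_norm_pow (by norm_num)).const_mul ‖B‖).mono'
    (continuous_bilin_diag B).aestronglyMeasurable (.of_forall fun x => ?_)
  refine (B.le_opNorm _).trans ?_
  simp

variable [CompleteSpace E]

/-- Integrating the Taylor expansion, the first order term vanishes because μ is centered. The
Lipschitz bound supplies integrability of F, which may be unbounded. -/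
lemma abs_integral_comp_add_sub_le {F : E → ℝ} {K : ℝ} {K' : ℝ≥0} (hF : ContDiff ℝ 3 F)
    (hL : LipschitzWith K' F)
    (hK : ∀ x, ‖iteratedFDeriv ℝ 3 F x‖ ≤ K) {μ : Measure E} [IsProbabilityMeasure μ]
    (hμ : MemLp id 3 μ) (h0 : ∫ x, x ∂μ = 0) (y : E) :
    |∫ x, F (y + x) ∂μ - (F y + 2⁻¹ * ∫ x, iteratedFDeriv ℝ 2 F y (fun _ => x) ∂μ)|
      ≤ K / 2 * ∫ x, ‖x‖ ^ 3 ∂μ := by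
  have i1 := integrable_id_of_memLp_three hμ
  have i2 := integrable_bilin_diag (iteratedFDeriv ℝ 2 F y) (hμ.mono_exponent (by norm_num))
  have i3 : Integrable (fun x : E => ‖x‖ ^ 3) μ := hμ.integrable_norm_pow (by norm_num)
  have iF := integrable_comp_add hL i1 y
  have iD : Integrable (fun x => fderiv ℝ F y x) μ := (fderiv ℝ F y).integrable_comp i1
  have eD : ∫ x, fderiv ℝ F y x ∂μ = 0 := by
    have := (fderiv ℝ F y).integral_comp_comm i1
    simp only [id] at this
    rw [this, h0, map_zero]
  have e : ∫ x, F (y + x) ∂μ - (F y + 2⁻¹ * ∫ x, iteratedFDeriv ℝ 2 F y (fun _ => x) ∂μ)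
      = ∫ x, (F (y + x) - (F y + fderiv ℝ F y x + 2⁻¹ * iteratedFDeriv ℝ 2 F y fun _ => x)) ∂μ := by
    have i4 : Integrable (fun x => F y + fderiv ℝ F y x) μ := (integrable_const _).add iD
    have i5 : Integrable (fun x => F y + fderiv ℝ F y x +
        2⁻¹ * iteratedFDeriv ℝ 2 F y fun _ => x) μ := i4.add (i2.const_mul _)
    rw [integral_sub iF i5, integral_add i4 (i2.const_mul _), integral_add (integrable_const _) iD,
      eD, integral_const_mul]
    simp
  rw [e, ← integral_const_mul]
  refine norm_integral_le_of_norm_le (f := fun x =>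
    F (y + x) - (F y + fderiv ℝ F y x + 2⁻¹ * iteratedFDeriv ℝ 2 F y fun _ => x))
    (i3.const_mul _) (.of_forall fun x => abs_taylor_two_remainder_le hF hK y x)

lemma TranslateClose.of_second_order {F : E → ℝ} {K : ℝ} {K' : ℝ≥0} (hF : ContDiff ℝ 3 F)
    (hL : LipschitzWith K' F)
    (hK : ∀ x, ‖iteratedFDeriv ℝ 3 F x‖ ≤ K) {μ ν : Measure E} [IsProbabilityMeasure μ]
    [IsProbabilityMeasure ν] (hμ : MemLp id 3 μ) (hν : MemLp id 3 ν) (hμ0 : ∫ x, x ∂μ = 0)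
    (hν0 : ∫ x, x ∂ν = 0) {δ : ℝ}
    (h : ∀ y, |∫ x, iteratedFDeriv ℝ 2 F y (fun _ => x) ∂μ -
      ∫ x, iteratedFDeriv ℝ 2 F y (fun _ => x) ∂ν| ≤ δ) :
    TranslateClose F μ ν (δ / 2 + K / 2 * (∫ x, ‖x‖ ^ 3 ∂μ + ∫ x, ‖x‖ ^ 3 ∂ν)) := fun y => by
  have h1 := abs_integral_comp_add_sub_le hF hL hK hμ hμ0 y
  have h2 := abs_integral_comp_add_sub_le hF hL hK hν hν0 y
  have h3 := h y
  rw [abs_le] at *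
  constructor <;> linarith [h1.1, h1.2, h2.1, h2.2, h3.1, h3.2]

end Taylor

/-! ### Comparison of centered Gaussian measures -/

section Gaussian

variable {E : Type*} [NormedAddCommGroup E] [NormedSpace ℝ E] [MeasurableSpace E] [BorelSpace E]
  [SecondCountableTopology E]

lemma integral_map_smul_eq_zero {γ : Measure E} (h0 : ∫ x, x ∂γ = 0) (c : ℝ) :
    ∫ x, x ∂(γ.map (c • ContinuousLinearMap.id ℝ E)) = 0 := by
  rw [integral_map (by fun_prop) (by fun_prop)]
  simp only [smul_apply, ContinuousLinearMap.id_apply]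
  rw [integral_smul, h0, smul_zero]

variable [CompleteSpace E]

/-- Stability of centered Gaussian laws, seen on characteristic functionals: each scaled copy has
variance `M⁻¹ * Var[L; γ]`, and M independent copies restore the exponent. -/
lemma IsGaussian.map_sum_pi_smul_eq {γ : Measure E} [IsGaussian γ] (h0 : ∫ x, x ∂γ = 0) {M : ℕ}
    (hM : M ≠ 0) :
    (Measure.pi fun _ : Fin M => γ.map ((√M)⁻¹ • ContinuousLinearMap.id ℝ E)).map
      (fun p => ∑ i, p i) = γ := by
  have hp := Measure.isProbabilityMeasure_map (μ := γ)
    ((√M)⁻¹ • ContinuousLinearMap.id ℝ E).measurable.aemeasurable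
  have : IsProbabilityMeasure ((Measure.pi fun _ : Fin M =>
      γ.map ((√M)⁻¹ • ContinuousLinearMap.id ℝ E)).map (fun p => ∑ i, p i)) :=
    Measure.isProbabilityMeasure_map (by fun_prop)
  refine Measure.ext_of_charFunDual ?_
  rw [charFunDual_map_sum_pi_eq_prod]
  ext L
  have hv : Var[L; γ.map ((√M)⁻¹ • ContinuousLinearMap.id ℝ E)] = (M : ℝ)⁻¹ * Var[L; γ] := by
    rw [variance_map (by fun_prop) (by fun_prop)]
    have : (L ∘ ⇑((√M)⁻¹ • ContinuousLinearMap.id ℝ E)) = fun x => (√M)⁻¹ * L x := by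
      ext x; simp
    rw [this, variance_const_mul, inv_pow, Real.sq_sqrt (Nat.cast_nonneg M)]
  rw [Finset.prod_apply, Finset.prod_const, Finset.card_univ, Fintype.card_fin,
    IsGaussian.charFunDual_eq_of_integral_eq_zero (by simpa using integral_map_smul_eq_zero h0 _),
    IsGaussian.charFunDual_eq_of_integral_eq_zero (by simpa using h0), hv, ← Complex.exp_nat_mul]
  congr 1
  have : (M : ℂ) ≠ 0 := by exact_mod_cast hM
  push_cast
  field_simp

/-- A direct second order exchange would leave the third moments of μ and ν, which are not small.
Splitting both laws into M scaled copies makes this contribution vanish in the limit, so only second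
moments matter. -/
lemma TranslateClose.of_isGaussian {F : E → ℝ} {K : ℝ} {K' : ℝ≥0} (hF : ContDiff ℝ 3 F)
    (hL : LipschitzWith K' F) (hK : ∀ x, ‖iteratedFDeriv ℝ 3 F x‖ ≤ K) {μ ν : Measure E}
    [IsGaussian μ] [IsGaussian ν] (hμ0 : ∫ x, x ∂μ = 0) (hν0 : ∫ x, x ∂ν = 0) {δ : ℝ}
    (h : ∀ y, |∫ x, iteratedFDeriv ℝ 2 F y (fun _ => x) ∂μ -
      ∫ x, iteratedFDeriv ℝ 2 F y (fun _ => x) ∂ν| ≤ δ) :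
    TranslateClose F μ ν (δ / 2) := by
  set m := K / 2 * (∫ x, ‖x‖ ^ 3 ∂μ + ∫ x, ‖x‖ ^ 3 ∂ν) with hm
  have key : ∀ M : ℕ, M ≠ 0 → TranslateClose F μ ν (δ / 2 + (√M)⁻¹ * m) := fun M hM => by
    set T : E →L[ℝ] E := (√M)⁻¹ • ContinuousLinearMap.id ℝ E with hT
    have hM' : (0 : ℝ) < M := by exact_mod_cast Nat.pos_of_ne_zero hM
    have hTn : ∀ x, T x = (√M)⁻¹ • x := fun x => by simp [hT]
    have e2 : ∀ (γ : Measure E) (y : E), ∫ x, iteratedFDeriv ℝ 2 F y (fun _ => x) ∂(γ.map T)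
        = (M : ℝ)⁻¹ * ∫ x, iteratedFDeriv ℝ 2 F y (fun _ => x) ∂γ := fun γ y => by
      rw [integral_map (by fun_prop)
        (continuous_bilin_diag _).aestronglyMeasurable,
        ← integral_const_mul]
      refine integral_congr_ae (.of_forall fun x => ?_)
      simp only [hTn]
      rw [ContinuousMultilinearMap.map_smul_univ (iteratedFDeriv ℝ 2 F y) (fun _ => (√M)⁻¹)]
      simp [Real.sq_sqrt hM'.le]
    have e3 : ∀ (γ : Measure E), ∫ x, ‖x‖ ^ 3 ∂(γ.map T)
        = (M : ℝ)⁻¹ * (√M)⁻¹ * ∫ x, ‖x‖ ^ 3 ∂γ := fun γ => by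
      rw [integral_map (by fun_prop) (by fun_prop), ← integral_const_mul]
      refine integral_congr_ae (.of_forall fun x => ?_)
      simp only [hTn, norm_smul, norm_inv, Real.norm_eq_abs, abs_of_nonneg (Real.sqrt_nonneg _)]
      have : ((√M)⁻¹) ^ 2 = (M : ℝ)⁻¹ := by rw [inv_pow, Real.sq_sqrt hM'.le]
      rw [← this]
      ring
    -- Scaling by M^{-1/2} multiplies second moments by 1/M and third moments by 1/M · M^{-1/2}; the
    -- M exchanges absorb the common factor 1/M.
    have hc : TranslateClose F (μ.map T) (ν.map T) ((M : ℝ)⁻¹ * (δ / 2 + (√M)⁻¹ * m)) := by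
      have := TranslateClose.of_second_order hF hL hK (μ := μ.map T) (ν := ν.map T)
        (IsGaussian.memLp_id _ _ (by norm_num)) (IsGaussian.memLp_id _ _ (by norm_num))
        (integral_map_smul_eq_zero hμ0 _) (integral_map_smul_eq_zero hν0 _)
        (δ := (M : ℝ)⁻¹ * δ) fun y => by
          rw [e2, e2, ← mul_sub, abs_mul, abs_of_pos (inv_pos.2 hM')]
          exact mul_le_mul_of_nonneg_left (h y) (inv_pos.2 hM').le
      rw [e3, e3] at this
      convert this using 1
      rw [hm]; ring
    have hint : ∀ (γ : Measure E) [IsGaussian γ] (i : Fin M),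
        Integrable (fun p : Fin M → E => p i) (Measure.pi fun _ => γ.map T) := fun γ _ i =>
      (measurePreserving_eval (fun _ : Fin M => γ.map T) i).integrable_comp_of_integrable
        (IsGaussian.integrable_id (μ := γ.map T))
    have hs := TranslateClose.sum hL (P := Measure.pi fun _ : Fin M => μ.map T)
      (P' := Measure.pi fun _ : Fin M => ν.map T) (X := fun i p => p i) (X' := fun i p => p i)
      (iIndepFun_pi (X := fun _ => id) fun _ => aemeasurable_id)
      (iIndepFun_pi (X := fun _ => id) fun _ => aemeasurable_id)
      (fun i => measurable_pi_apply i) (fun i => measurable_pi_apply i)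
      (hint μ) (hint ν) (ε := fun _ => (M : ℝ)⁻¹ * (δ / 2 + (√M)⁻¹ * m)) (fun i => by
        have e : ∀ (γ : Measure E) [IsGaussian γ],
            (Measure.pi fun _ : Fin M => γ.map T).map (fun p => p i) = γ.map T :=
          fun γ _ => (measurePreserving_eval (fun _ : Fin M => γ.map T) i).map_eq
        rw [e μ, e ν]
        exact hc) Finset.univ
    have e : (∑ i : Fin M, fun p : Fin M → E => p i) = fun p => ∑ i, p i := by
      ext p; simp
    rw [e, IsGaussian.map_sum_pi_smul_eq hμ0 hM, IsGaussian.map_sum_pi_smul_eq hν0 hM,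
      Finset.sum_const, Finset.card_univ, Fintype.card_fin, nsmul_eq_mul, ← mul_assoc,
      mul_inv_cancel₀ hM'.ne', one_mul] at hs
    exact hs
  intro y
  have hl : Filter.Tendsto (fun M : ℕ => δ / 2 + (√(M : ℝ))⁻¹ * m) Filter.atTop
      (nhds (δ / 2 + 0 * m)) :=
    ((tendsto_inv_atTop_zero.comp (Real.tendsto_sqrt_atTop.comp
      tendsto_natCast_atTop_atTop)).mul_const m).const_add _
  rw [zero_mul, add_zero] at hl
  exact ge_of_tendsto hl (Filter.eventually_atTop.2 ⟨1, fun M hM => key M (by omega) y⟩)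

end Gaussian

/-! ### Second moments and Hilbert-Schmidt forms -/

section HilbertSchmidtMoments

variable {E : Type*} [NormedAddCommGroup E] [InnerProductSpace ℝ E]

/-- A bilinear form in two variables from a continuous multilinear form. -/
def bilinOfMultilinear (B : E [×2]→L[ℝ] ℝ) : E →ₗ[ℝ] E →ₗ[ℝ] ℝ :=
  LinearMap.mk₂ ℝ (fun x y => B ![x, y])
    (fun x x' y => by simpa using! B.cons_add ![y] x x')
    (fun c x y => by simpa using! B.cons_smul ![y] c x)
    (fun x y y' => by
      have e : ∀ z, Function.update ![x, 0] 1 z = ![x, z] := fun z => by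
        ext i; fin_cases i <;> simp
      simpa only [e] using B.map_update_add ![x, 0] 1 y y')
    (fun c x y => by
      have e : ∀ z, Function.update ![x, 0] 1 z = ![x, z] := fun z => by
        ext i; fin_cases i <;> simp
      simpa only [e] using B.map_update_smul ![x, 0] 1 c y)

lemma apply_diag_sum (B : E [×2]→L[ℝ] ℝ) {ι : Type*} (s : Finset ι) (c : ι → ℝ) (b : ι → E) :
    (B fun _ => ∑ i ∈ s, c i • b i) = ∑ i ∈ s, ∑ j ∈ s, B ![b i, b j] * (c i * c j) := by
  have e : ∀ x, (B fun _ => x) = bilinOfMultilinear B x x := fun x => by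
    change _ = B ![x, x]
    congr 1; ext i; fin_cases i <;> rfl
  rw [e]
  simp only [map_sum, LinearMap.sum_apply, map_smul, LinearMap.smul_apply, smul_eq_mul,
    Finset.mul_sum]
  rw [Finset.sum_comm]
  refine Finset.sum_congr rfl fun i _ => Finset.sum_congr rfl fun j _ => ?_
  change c j * (c i * B ![b i, b j]) = _
  ring

lemma sum_sq_le_hsENorm_sq [CompleteSpace E] (B : E [×2]→L[ℝ] ℝ) (hB : hsENorm B ≠ ∞) {ι : Type*}
    (b : HilbertBasis ι ℝ E) (s : Finset ι) :
    ∑ i ∈ s, ∑ j ∈ s, B ![b i, b j] ^ 2 ≤ (hsENorm B).toReal ^ 2 := by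
  have h1 : ∑ i ∈ s, ∑ j ∈ s, ‖B ![b i, b j]‖ₑ ^ 2 ≤ hsENorm B ^ 2 := by
    rw [hsENorm_eq B b, ← ENNReal.rpow_natCast, ← ENNReal.rpow_mul]
    norm_num
    exact (Finset.sum_le_sum fun i _ => ENNReal.sum_le_tsum s).trans (ENNReal.sum_le_tsum s)
  have h2 := ENNReal.toReal_mono (ENNReal.pow_ne_top hB) h1
  rw [ENNReal.toReal_pow] at h2
  refine le_trans (le_of_eq ?_) h2
  rw [ENNReal.toReal_sum fun i _ => by simp [ENNReal.sum_eq_top]]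
  refine Finset.sum_congr rfl fun i _ => ?_
  rw [ENNReal.toReal_sum fun i _ => by simp]
  refine Finset.sum_congr rfl fun j _ => ?_
  simp

variable [MeasurableSpace E] [BorelSpace E]

/-- The partial sum over s × s is the integral of B on the diagonal at the orthogonal projection of
x onto the span of the `b i`, i ∈ s. The projections converge to x, and Bessel's inequality gives
the dominating function ‖B‖ ‖x‖². -/
lemma tendsto_sum_bilin_moments (B : E [×2]→L[ℝ] ℝ) {ι : Type*} [Countable ι]
    (b : HilbertBasis ι ℝ E) {μ : Measure E} (hμ : MemLp id 2 μ) :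
    Filter.Tendsto (fun s : Finset ι => ∑ i ∈ s, ∑ j ∈ s, B ![b i, b j] *
      ∫ x, inner ℝ (b i) x * inner ℝ (b j) x ∂μ) Filter.atTop
      (nhds (∫ x, B (fun _ => x) ∂μ)) := by
  have h2 : Integrable (fun x : E => ‖x‖ ^ 2) μ := hμ.integrable_norm_pow (by norm_num)
  have hij : ∀ i j, Integrable (fun x => inner ℝ (b i) x * inner ℝ (b j) x) μ := fun i j => by
    refine h2.mono' (by fun_prop) (.of_forall fun x => ?_)
    rw [norm_mul, sq]
    have h : ∀ i, ‖inner ℝ (b i) x‖ ≤ ‖x‖ := fun i => by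
      simpa [b.orthonormal.1 i] using norm_inner_le_norm (𝕜 := ℝ) (b i) x
    exact mul_le_mul (h i) (h j) (norm_nonneg _) (norm_nonneg _)
  have e : ∀ s : Finset ι, ∑ i ∈ s, ∑ j ∈ s, B ![b i, b j] *
      ∫ x, inner ℝ (b i) x * inner ℝ (b j) x ∂μ
      = ∫ x, B (fun _ => ∑ i ∈ s, inner ℝ (b i) x • b i) ∂μ := fun s => by
    simp only [apply_diag_sum B s _ b]
    rw [integral_finsetSum _ fun i _ => integrable_finsetSum _ fun j _ => (hij i j).const_mul _]
    refine Finset.sum_congr rfl fun i _ => ?_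
    rw [integral_finsetSum _ fun j _ => (hij i j).const_mul _]
    exact Finset.sum_congr rfl fun j _ => (integral_const_mul _ _).symm
  simp only [e]
  refine tendsto_integral_filter_of_dominated_convergence (fun x => ‖B‖ * ‖x‖ ^ 2)
    (.of_forall fun s => ((continuous_bilin_diag B).comp
      (by fun_prop)).aestronglyMeasurable)
    (.of_forall fun s => .of_forall fun x => ?_) (h2.const_mul _) (.of_forall fun x => ?_)
  · refine (B.le_opNorm _).trans ?_
    simp only [Finset.prod_const, Finset.card_univ, Fintype.card_fin]
    gcongr
    rw [← sq_le_sq₀ (norm_nonneg _) (norm_nonneg _), ← real_inner_self_eq_norm_sq,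
      b.orthonormal.inner_sum]
    refine le_trans (le_of_eq ?_) (b.orthonormal.sum_inner_products_le x (s := s))
    refine Finset.sum_congr rfl fun i _ => ?_
    rw [Real.norm_eq_abs, sq_abs, sq]
    rfl
  · have := b.hasSum_repr x
    simp only [b.repr_apply_apply] at this
    exact ((continuous_bilin_diag B).tendsto x).comp this

variable [CompleteSpace E]

/-- Bilinear forms in the Hilbert-Schmidt class see second moments in the Hilbert-Schmidt norm. -/
lemma abs_integral_bilin_sub_le (B : E [×2]→L[ℝ] ℝ) (hB : hsENorm B ≠ ∞) {ι : Type*} [Countable ι]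
    (b : HilbertBasis ι ℝ E) {μ ν : Measure E} (hμ : MemLp id 2 μ) (hν : MemLp id 2 ν)
    {a : ι → ℝ} (ha : Summable fun i => a i ^ 2)
    (h : ∀ i j, |∫ x, inner ℝ (b i) x * inner ℝ (b j) x ∂μ -
      ∫ x, inner ℝ (b i) x * inner ℝ (b j) x ∂ν| ≤ a i * a j) :
    |∫ x, B (fun _ => x) ∂μ - ∫ x, B (fun _ => x) ∂ν| ≤
      (hsENorm B).toReal * ∑' i, a i ^ 2 := by
  refine le_of_tendsto (((tendsto_sum_bilin_moments B b hμ).sub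
    (tendsto_sum_bilin_moments B b hν)).abs) (.of_forall fun s => ?_)
  rw [← Finset.sum_sub_distrib]
  simp only [← Finset.sum_sub_distrib, ← mul_sub]
  rw [← Finset.sum_product' s s]
  -- Cauchy-Schwarz over pairs of indices. Since the moment differences are dominated by the rank
  -- one kernel `a i * a j`, their squares sum to at most (∑ a_i²)².
  have hcs := Finset.sum_mul_sq_le_sq_mul_sq (s ×ˢ s) (fun x => B ![b x.1, b x.2])
    (fun x => ∫ y, inner ℝ (b x.1) y * inner ℝ (b x.2) y ∂μ -
      ∫ y, inner ℝ (b x.1) y * inner ℝ (b x.2) y ∂ν)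
  have h1 : ∑ x ∈ s ×ˢ s, B ![b x.1, b x.2] ^ 2 ≤ (hsENorm B).toReal ^ 2 := by
    rw [Finset.sum_product]
    exact sum_sq_le_hsENorm_sq B hB b s
  have h2 : ∑ x ∈ s ×ˢ s, (∫ y, inner ℝ (b x.1) y * inner ℝ (b x.2) y ∂μ -
      ∫ y, inner ℝ (b x.1) y * inner ℝ (b x.2) y ∂ν) ^ 2 ≤ (∑' i, a i ^ 2) ^ 2 := by
    calc _ ≤ ∑ x ∈ s ×ˢ s, a x.1 ^ 2 * a x.2 ^ 2 := Finset.sum_le_sum fun x _ => by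
          rw [← sq_abs, ← mul_pow]
          exact pow_le_pow_left₀ (abs_nonneg _) (h _ _) 2
      _ = (∑ i ∈ s, a i ^ 2) ^ 2 := by rw [Finset.sum_product, sq, Finset.sum_mul_sum]
      _ ≤ _ := by
        have := ha.sum_le_tsum s fun i _ => sq_nonneg _
        have h0 : 0 ≤ ∑ i ∈ s, a i ^ 2 := Finset.sum_nonneg fun i _ => sq_nonneg _
        gcongr
  refine abs_le_of_sq_le_sq (hcs.trans ?_)
    (mul_nonneg ENNReal.toReal_nonneg (tsum_nonneg fun i => sq_nonneg _))
  rw [mul_pow]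
  exact mul_le_mul h1 h2 (Finset.sum_nonneg fun i _ => sq_nonneg _) (sq_nonneg _)

end HilbertSchmidtMoments

/-! ### Bounds contained in the `C^m_{l,HS}` norm -/

section ClHS

variable {E : Type*} [NormedAddCommGroup E] [InnerProductSpace ℝ E] [CompleteSpace E]

lemma MemClHS.norm_iteratedFDeriv_le {m : ℕ} {F : E → ℝ} (hF : MemClHS m F) {k : ℕ} (hk : 1 ≤ k)
    (hkm : k ≤ m) (x : E) : ‖iteratedFDeriv ℝ k F x‖ ≤ clHSNorm m F := by
  rw [← toReal_enorm]
  refine ENNReal.toReal_mono hF.2.ne (le_trans ?_ (le_add_of_nonneg_right zero_le))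
  exact (le_iSup (fun x => ‖iteratedFDeriv ℝ k F x‖ₑ) x).trans
    (Finset.single_le_sum (f := fun k => ⨆ x, ‖iteratedFDeriv ℝ k F x‖ₑ) (fun _ _ => zero_le)
      (Finset.mem_Icc.2 ⟨hk, hkm⟩))

lemma MemClHS.hsENorm_le {m : ℕ} {F : E → ℝ} (x : E) :
    hsENorm (iteratedFDeriv ℝ 2 F x) ≤ clHSENorm m F :=
  (le_iSup (fun x => hsENorm (iteratedFDeriv ℝ 2 F x)) x).trans
    (le_add_of_nonneg_left zero_le)

lemma clHSNorm_nonneg (m : ℕ) (F : E → ℝ) : 0 ≤ clHSNorm m F := ENNReal.toReal_nonneg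

lemma MemClHS.lipschitzWith {m : ℕ} (hm : 1 ≤ m) {F : E → ℝ} (hF : MemClHS m F) :
    LipschitzWith (clHSNorm m F).toNNReal F := by
  refine lipschitzWith_of_nnnorm_fderiv_le (𝕜 := ℝ)
    (hF.1.differentiable (by exact_mod_cast (by omega : m ≠ 0))) fun x => ?_
  rw [← NNReal.coe_le_coe, coe_nnnorm, Real.coe_toNNReal _ (clHSNorm_nonneg _ _),
    ← norm_iteratedFDeriv_one]
  exact hF.norm_iteratedFDeriv_le le_rfl hm x

end ClHS

/-! ### Gaussian approximation of sums of independent scalar multiples of vectors -/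

section Scalar

variable {E : Type*} [NormedAddCommGroup E] [NormedSpace ℝ E] [MeasurableSpace E] [BorelSpace E]

lemma integral_bilin_map_smul {Ω : Type*} [MeasurableSpace Ω] {P : Measure Ω} {Z : Ω → ℝ}
    (hZ : Measurable Z) (v : E) (B : E [×2]→L[ℝ] ℝ) :
    ∫ x, B (fun _ => x) ∂(P.map fun ω => Z ω • v) = (B fun _ => v) * ∫ ω, Z ω ^ 2 ∂P := by
  rw [integral_map (by fun_prop) (continuous_bilin_diag B).aestronglyMeasurable,
    ← integral_const_mul]
  refine integral_congr_ae (.of_forall fun ω => ?_)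
  simp only
  rw [ContinuousMultilinearMap.map_smul_univ B (fun _ => Z ω)]
  simp [mul_comm]

variable [SecondCountableTopology E]

lemma memLp_id_map_smul {Ω : Type*} [MeasurableSpace Ω] {P : Measure Ω} {Z : Ω → ℝ}
    (hZ : Measurable Z) {p : ℝ≥0∞} (hp : MemLp Z p P) (v : E) :
    MemLp id p (P.map fun ω => Z ω • v) := by
  rw [memLp_map_measure_iff (by fun_prop) (by fun_prop)]
  refine (hp.norm.const_mul ‖v‖).mono (by fun_prop) (.of_forall fun ω => ?_)
  simp [norm_smul, mul_comm]

lemma integral_map_smul_vec [CompleteSpace E] {Ω : Type*} [MeasurableSpace Ω] {P : Measure Ω}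
    {Z : Ω → ℝ} (hZ : Measurable Z) (h0 : ∫ ω, Z ω ∂P = 0) (v : E) :
    ∫ x, x ∂(P.map fun ω => Z ω • v) = 0 := by
  rw [integral_map (by fun_prop) (by fun_prop), integral_smul_const, h0, zero_smul]

lemma integral_norm_map_smul {Ω : Type*} [MeasurableSpace Ω] {P : Measure Ω} {Z : Ω → ℝ}
    (hZ : Measurable Z) (v : E) :
    ∫ x, ‖x‖ ^ 3 ∂(P.map fun ω => Z ω • v) = ‖v‖ ^ 3 * ∫ ω, |Z ω| ^ 3 ∂P := by
  rw [integral_map (by fun_prop) (by fun_prop), ← integral_const_mul]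
  refine integral_congr_ae (.of_forall fun ω => ?_)
  simp only [norm_smul, Real.norm_eq_abs]
  ring

/-- With equal variances the second order terms, both equal to `B(v, v)` times the variance, cancel;
hence δ = 0 in `TranslateClose.of_second_order`. -/
lemma TranslateClose.map_smul [CompleteSpace E] {F : E → ℝ} {K : ℝ} {K' : ℝ≥0}
    (hF : ContDiff ℝ 3 F) (hL : LipschitzWith K' F) (hK : ∀ x, ‖iteratedFDeriv ℝ 3 F x‖ ≤ K)
    {Ω Ω' : Type*} [MeasurableSpace Ω] [MeasurableSpace Ω'] {P : Measure Ω} {P' : Measure Ω'}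
    [IsProbabilityMeasure P] [IsProbabilityMeasure P'] {Z : Ω → ℝ} {Z' : Ω' → ℝ}
    (hZ : Measurable Z) (hZ' : Measurable Z') (hp : MemLp Z 3 P) (hp' : MemLp Z' 3 P')
    (h0 : ∫ ω, Z ω ∂P = 0) (h0' : ∫ ω, Z' ω ∂P' = 0)
    (h2 : ∫ ω, Z ω ^ 2 ∂P = ∫ ω, Z' ω ^ 2 ∂P') (v : E) :
    TranslateClose F (P.map fun ω => Z ω • v) (P'.map fun ω => Z' ω • v)
      (K / 2 * (‖v‖ ^ 3 * (∫ ω, |Z ω| ^ 3 ∂P + ∫ ω, |Z' ω| ^ 3 ∂P'))) := by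
  have hm : Measurable fun ω => Z ω • v := by fun_prop
  have hm' : Measurable fun ω => Z' ω • v := by fun_prop
  have := Measure.isProbabilityMeasure_map (μ := P) hm.aemeasurable
  have := Measure.isProbabilityMeasure_map (μ := P') hm'.aemeasurable
  have key := TranslateClose.of_second_order hF hL hK (memLp_id_map_smul hZ hp v)
    (memLp_id_map_smul hZ' hp' v) (integral_map_smul_vec hZ h0 v)
    (integral_map_smul_vec hZ' h0' v) (δ := 0) fun y => by
      rw [integral_bilin_map_smul hZ, integral_bilin_map_smul hZ', h2, sub_self, abs_zero]
  rwa [integral_norm_map_smul hZ, integral_norm_map_smul hZ', zero_div, zero_add, ← mul_add] at key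

end Scalar

/-- The third absolute moment of a standard normal variable. -/
def gaussThird : ℝ := ∫ x, |x| ^ 3 ∂(gaussianReal 0 1)

/-! ### Independent standard normal variables. -/

section StandardNormals

variable {X : Type*} [Fintype X]

/-- The law of independent standard normal variables. -/
abbrev stdNormals (X : Type*) [Fintype X] : Measure (X → ℝ) := Measure.pi fun _ => gaussianReal 0 1

lemma iIndepFun_stdNormals : iIndepFun (fun (x : X) p => p x) (stdNormals X) :=
  iIndepFun_pi (X := fun _ => id) fun _ => aemeasurable_id

lemma measurePreserving_stdNormals (x : X) :
    MeasurePreserving (fun p : X → ℝ => p x) (stdNormals X) (gaussianReal 0 1) :=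
  measurePreserving_eval (fun _ : X => gaussianReal 0 1) x

lemma memLp_stdNormals (x : X) (q : ℝ≥0) : MemLp (fun p : X → ℝ => p x) q (stdNormals X) :=
  (memLp_id_gaussianReal q).comp_measurePreserving (measurePreserving_stdNormals x)

lemma integral_comp_stdNormals (x : X) (g : ℝ → ℝ) (hg : Continuous g) :
    ∫ p : X → ℝ, g (p x) ∂(stdNormals X) = ∫ t, g t ∂(gaussianReal 0 1) := by
  rw [← (measurePreserving_stdNormals x).map_eq, integral_map (measurable_pi_apply x).aemeasurable
    hg.aestronglyMeasurable]

lemma integral_stdNormals (x : X) : ∫ p : X → ℝ, p x ∂(stdNormals X) = 0 := by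
  rw [integral_comp_stdNormals x (fun t => t) continuous_id]
  simp

lemma integral_sq_stdNormals (x : X) : ∫ p : X → ℝ, p x ^ 2 ∂(stdNormals X) = 1 := by
  rw [integral_comp_stdNormals x (fun t => t ^ 2) (by fun_prop)]
  have := variance_of_integral_eq_zero (μ := gaussianReal 0 1) aemeasurable_id (by simp)
  simpa using this.symm

lemma integral_mul_stdNormals [DecidableEq X] (x y : X) :
    ∫ p : X → ℝ, p x * p y ∂(stdNormals X) = if x = y then 1 else 0 := by
  split_ifs with h
  · subst h
    simpa only [sq] using integral_sq_stdNormals x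
  · have := (iIndepFun_stdNormals.indepFun h).integral_fun_mul_eq_mul_integral
      (memLp_stdNormals x 1).1 (memLp_stdNormals y 1).1
    rw [this, integral_stdNormals, zero_mul]

end StandardNormals

/-! ### Finite Gaussian sums in a Hilbert space and the abstract Berry-Esseen bound. -/

section BerryEsseen

variable {E : Type*} [NormedAddCommGroup E] [InnerProductSpace ℝ E] {X : Type*} [Fintype X]

/-- The Gaussian vector `∑ σ_x h_x v_x` with independent standard normal `h_x`. -/
def gaussSum (σ : X → ℝ) (v : X → E) : (X → ℝ) → E := ∑ x, fun p => (σ x * p x) • v x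

lemma gaussSum_apply (σ : X → ℝ) (v : X → E) (p : X → ℝ) :
    gaussSum σ v p = ∑ x, (σ x * p x) • v x := by
  simp [gaussSum]

lemma integrable_gaussSum_term (σ : X → ℝ) (v : X → E) (x : X) :
    Integrable (fun p : X → ℝ => (σ x * p x) • v x) (stdNormals X) :=
  ((memLp_one_iff_integrable.1 (memLp_stdNormals x 1)).const_mul (σ x)).smul_const (v x)

variable [MeasurableSpace E] [BorelSpace E]

lemma iIndepFun_gaussSum_terms (σ : X → ℝ) (v : X → E) :
    iIndepFun (fun x (p : X → ℝ) => (σ x * p x) • v x) (stdNormals X) :=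
  iIndepFun_stdNormals.comp (fun x t => (σ x * t) • v x) fun x => by fun_prop

variable [SecondCountableTopology E]

lemma measurable_gaussSum (σ : X → ℝ) (v : X → E) : Measurable (gaussSum σ v) := by
  unfold gaussSum; fun_prop

lemma integral_inner_gaussSum (σ : X → ℝ) (v : X → E) (a b : E) :
    ∫ z, inner ℝ a z * inner ℝ b z ∂((stdNormals X).map (gaussSum σ v))
      = ∑ x, σ x ^ 2 * (inner ℝ a (v x) * inner ℝ b (v x)) := by
  classical
  rw [integral_map (measurable_gaussSum σ v).aemeasurable (by fun_prop)]
  simp only [gaussSum_apply, inner_sum, Finset.sum_mul_sum, inner_smul_right]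
  have hi : ∀ x y, Integrable (fun p : X → ℝ => σ x * p x * inner ℝ a (v x) *
      (σ y * p y * inner ℝ b (v y))) (stdNormals X) := fun x y => by
    have h := (MemLp.integrable_mul (p := 2) (q := 2) (memLp_stdNormals x 2)
      (memLp_stdNormals y 2)).const_mul
      (σ x * inner ℝ a (v x) * (σ y * inner ℝ b (v y)))
    refine h.congr (.of_forall fun p => ?_)
    simp only [Pi.mul_apply]
    ring
  rw [integral_finsetSum _ fun x _ => integrable_finsetSum _ fun y _ => hi x y]
  refine Finset.sum_congr rfl fun x _ => ?_
  rw [integral_finsetSum _ fun y _ => hi x y]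
  have e : ∀ y, ∫ p : X → ℝ, σ x * p x * inner ℝ a (v x) * (σ y * p y * inner ℝ b (v y))
      ∂(stdNormals X) = (σ x * inner ℝ a (v x) * (σ y * inner ℝ b (v y))) *
        if x = y then 1 else 0 := fun y => by
    rw [← integral_mul_stdNormals, ← integral_const_mul]
    refine integral_congr_ae (.of_forall fun p => ?_)
    simp only
    ring
  simp only [e, mul_ite, mul_one, mul_zero, Finset.sum_ite_eq, Finset.mem_univ, if_true]
  ring

variable [CompleteSpace E]

lemma isGaussian_map_gaussSum (σ : X → ℝ) (v : X → E) :
    IsGaussian ((stdNormals X).map (gaussSum σ v)) := by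
  refine (iIndepFun.hasGaussianLaw_sum (fun x => ⟨?_⟩) (iIndepFun_gaussSum_terms σ v)).isGaussian_map
  let L : ℝ →L[ℝ] E := ContinuousLinearMap.toSpanSingleton ℝ (σ x • v x)
  have e : (fun p : X → ℝ => (σ x * p x) • v x) = L ∘ fun p => p x := by
    ext p
    simp [L, smul_smul, mul_comm]
  rw [e, ← Measure.map_map L.measurable (measurable_pi_apply x),
    (measurePreserving_stdNormals x).map_eq]
  infer_instance

lemma integral_gaussSum (σ : X → ℝ) (v : X → E) :
    ∫ z, z ∂((stdNormals X).map (gaussSum σ v)) = 0 := by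
  rw [integral_map (measurable_gaussSum σ v).aemeasurable (by fun_prop)]
  simp only [gaussSum_apply]
  rw [integral_finsetSum _ fun x _ => integrable_gaussSum_term σ v x]
  refine Finset.sum_eq_zero fun x _ => ?_
  rw [integral_smul_const, integral_const_mul, integral_stdNormals, mul_zero, zero_smul]

/-- Gaussian comparison for a sum of independent bounded multiples of fixed vectors in a
Hilbert space. -/
lemma TranslateClose.berryEsseen {F : E → ℝ} (hF : MemClHS 3 F) {Ω : Type*} [MeasurableSpace Ω]
    {P : Measure Ω} [IsProbabilityMeasure P] {Z : X → Ω → ℝ} (hZ : iIndepFun Z P)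
    (hm : ∀ x, Measurable (Z x)) (hb : ∀ x ω, |Z x ω| ≤ 1) (h0 : ∀ x, ∫ ω, Z x ω ∂P = 0)
    (v : X → E) {γ : Measure E} [IsGaussian γ] (hγ : ∫ z, z ∂γ = 0)
    {ι : Type*} [Countable ι] (b : HilbertBasis ι ℝ E) {a : ι → ℝ}
    (ha : Summable fun i => a i ^ 2)
    (h : ∀ i j, |∑ x, (∫ ω, Z x ω ^ 2 ∂P) * (inner ℝ (b i) (v x) * inner ℝ (b j) (v x)) -
      ∫ z, inner ℝ (b i) z * inner ℝ (b j) z ∂γ| ≤ a i * a j) :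
    TranslateClose F (P.map (∑ x, fun ω => Z x ω • v x)) γ
      (clHSNorm 3 F * ((1 + gaussThird) / 2 * ∑ x, ‖v x‖ ^ 3 + (∑' i, a i ^ 2) / 2)) := by
  set K := clHSNorm 3 F with hKdef
  have hL : LipschitzWith K.toNNReal F := hF.lipschitzWith (by norm_num)
  have hK : ∀ x, ‖iteratedFDeriv ℝ 3 F x‖ ≤ K :=
    hF.norm_iteratedFDeriv_le (by norm_num) le_rfl
  have hc : ContDiff ℝ 3 F := hF.1
  have hK0 : 0 ≤ K := clHSNorm_nonneg 3 F
  have hbd : ∀ x (q : ℝ≥0∞), MemLp (Z x) q P := fun x q =>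
    MemLp.of_bound (hm x).aestronglyMeasurable 1 (.of_forall fun ω => hb x ω)
  have hs0 : ∀ x, 0 ≤ ∫ ω, Z x ω ^ 2 ∂P := fun x => integral_nonneg fun ω => sq_nonneg _
  have hle : ∀ x (k : ℕ), ∫ ω, |Z x ω| ^ k ∂P ≤ 1 := fun x k => by
    have := integral_mono_of_nonneg (μ := P) (f := fun ω => |Z x ω| ^ k) (g := fun _ => 1)
      (.of_forall fun ω => pow_nonneg (abs_nonneg _) k) (integrable_const _)
      (.of_forall fun ω => pow_le_one₀ (abs_nonneg _) (hb x ω))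
    simpa using this
  have hs1 : ∀ x, ∫ ω, Z x ω ^ 2 ∂P ≤ 1 := fun x => by simpa only [sq_abs] using hle x 2
  -- The standard deviation of `Z x`, so that the Gaussian substitute has the same variance; |Z| ≤ 1
  -- gives σ ≤ 1.
  set σ : X → ℝ := fun x => √(∫ ω, Z x ω ^ 2 ∂P) with hσ
  have hσ2 : ∀ x, σ x ^ 2 = ∫ ω, Z x ω ^ 2 ∂P := fun x => Real.sq_sqrt (hs0 x)
  have hσ1 : ∀ x, σ x ≤ 1 := fun x => Real.sqrt_le_one.2 (hs1 x)
  have hg0 : 0 ≤ gaussThird := integral_nonneg fun t => pow_nonneg (abs_nonneg _) 3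
  -- Lindeberg exchange: 1 bounds the third moment of `Z x`, and `gaussThird` that of its Gaussian
  -- substitute.
  have h1 : TranslateClose F (P.map (∑ x, fun ω => Z x ω • v x))
      ((stdNormals X).map (gaussSum σ v)) (∑ x, K / 2 * (‖v x‖ ^ 3 * (1 + gaussThird))) := by
    refine TranslateClose.sum hL (X := fun x ω => Z x ω • v x)
      (X' := fun x (p : X → ℝ) => (σ x * p x) • v x)
      (hZ.comp (fun x t => t • v x) fun x => by fun_prop)
      (iIndepFun_gaussSum_terms σ v) (fun x => (hm x).smul_const (v x)) (fun x => by fun_prop)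
      (fun x => (memLp_one_iff_integrable.1 (hbd x 1)).smul_const (v x))
      (fun x => integrable_gaussSum_term σ v x) (fun x => ?_) Finset.univ
    have hx := TranslateClose.map_smul hc hL hK (P := P) (P' := stdNormals X) (Z := Z x)
      (Z' := fun p => σ x * p x) (hm x) (by fun_prop) (hbd x 3)
      ((memLp_stdNormals x 3).const_mul (σ x)) (h0 x)
      (by rw [integral_const_mul, integral_stdNormals, mul_zero])
      (by simp only [mul_pow]; rw [integral_const_mul, integral_sq_stdNormals, mul_one, hσ2]) (v x)
    intro y
    refine (hx y).trans ?_
    gcongr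
    · exact hle x 3
    · have e : ∫ p : X → ℝ, |σ x * p x| ^ 3 ∂(stdNormals X) = σ x ^ 3 * gaussThird := by
        rw [gaussThird, ← integral_comp_stdNormals x (fun t => |t| ^ 3) (by fun_prop),
          ← integral_const_mul]
        refine integral_congr_ae (.of_forall fun p => ?_)
        simp only [abs_mul, abs_of_nonneg (Real.sqrt_nonneg _), hσ]
        ring
      rw [e]
      exact mul_le_of_le_one_left hg0 (pow_le_one₀ (Real.sqrt_nonneg _) (hσ1 x))
  have := isGaussian_map_gaussSum σ v
  -- Gaussian exchange: the two laws differ only in their covariances, measured in the basis `b`.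
  have h2 : TranslateClose F ((stdNormals X).map (gaussSum σ v)) γ (K * (∑' i, a i ^ 2) / 2) := by
    refine TranslateClose.of_isGaussian hc hL hK (integral_gaussSum σ v) hγ fun y => ?_
    have hB := MemClHS.hsENorm_le (m := 3) (F := F) y
    refine (abs_integral_bilin_sub_le _ (ne_top_of_le_ne_top hF.2.ne hB) b
      (IsGaussian.memLp_id _ _ (by norm_num)) (IsGaussian.memLp_id _ _ (by norm_num)) ha
      fun i j => ?_).trans ?_
    · rw [integral_inner_gaussSum]
      simp only [hσ2]
      exact h i j
    · exact mul_le_mul_of_nonneg_right (ENNReal.toReal_mono hF.2.ne hB)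
        (tsum_nonneg fun i => sq_nonneg _)
  convert h1.trans h2 using 1
  rw [← Finset.mul_sum, ← Finset.sum_mul]
  ring

end BerryEsseen

section TrigBasis

variable {d : ℕ}

/-! ### The real trigonometric basis of `L₂(𝕋^d)` -/

/-- The function `cas (k·x) = cos (k·x) + sin (k·x)`. -/
def cas (k : Fin d → ℤ) : C(Torus d, ℝ) where
  toFun x := (char k x).re + (char k x).im
  continuous_toFun := by fun_prop

lemma cas_apply (k : Fin d → ℤ) (x : Torus d) : cas k x = (char k x).re + (char k x).im := rfl

lemma norm_char (k : Fin d → ℤ) (x : Torus d) : ‖char k x‖ = 1 := by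
  simp only [char, ContinuousMap.coe_mk, norm_prod, fourier_apply, Circle.norm_coe,
    Finset.prod_const_one]

lemma ofReal_cas (k : Fin d → ℤ) (x : Torus d) :
    (cas k x : ℂ) = ((1 - Complex.I) * char k x + (1 + Complex.I) * conj (char k x)) / 2 := by
  apply Complex.ext
  · simp [cas_apply]
  · simp [cas_apply]
    ring

lemma abs_cas_le (k : Fin d → ℤ) (x : Torus d) : |cas k x| ≤ 2 := by
  have h1 := Complex.abs_re_le_norm (char k x)
  have h2 := Complex.abs_im_le_norm (char k x)
  rw [norm_char] at h1 h2
  rw [cas_apply]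
  exact (abs_add_le _ _).trans (by linarith)

lemma integral_char (k : Fin d → ℤ) :
    ∫ x, char k x ∂(torusMeasure d) = if k = 0 then 1 else 0 := by
  have h := (orthonormal_iff_ite.1 (orthonormal_charLp d)) 0 k
  simp only [charLp, ContinuousMap.inner_toLp, char_zero] at h
  simpa [eq_comm] using h

/-- `cas (k·x)` as an element of `L₂(𝕋^d)`. -/
def casL (k : Fin d → ℤ) : L2Torus d := ContinuousMap.toLp (E := ℝ) 2 (torusMeasure d) ℝ (cas k)

lemma casL_coeFn (k : Fin d → ℤ) : casL k =ᵐ[torusMeasure d] cas k :=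
  ContinuousMap.coeFn_toLp _ _

lemma integrable_of_continuous {G : Type*} [NormedAddCommGroup G] {f : Torus d → G}
    (hf : Continuous f) : Integrable f (torusMeasure d) :=
  hf.integrable_of_hasCompactSupport (HasCompactSupport.of_compactSpace f)

lemma coeff_casL (k m : Fin d → ℤ) :
    coeff (casL k) m = ((1 - Complex.I) * (if m = k then 1 else 0) +
      (1 + Complex.I) * (if m = -k then 1 else 0)) / 2 := by
  have e : coeff (casL k) m = ∫ x, ((1 - Complex.I) * char (k - m) x +
      (1 + Complex.I) * char (-k - m) x) / 2 ∂(torusMeasure d) := by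
    refine integral_congr_ae ?_
    filter_upwards [casL_coeFn k] with x hx
    rw [hx, ofReal_cas, sub_eq_add_neg k, sub_eq_add_neg (-k), char_add, char_add, char_neg,
      char_neg]
    ring
  rw [e, integral_div, integral_add
    ((integrable_of_continuous (map_continuous _)).const_mul _)
    ((integrable_of_continuous (map_continuous _)).const_mul _),
    integral_const_mul, integral_const_mul, integral_char, integral_char]
  have h1 : k - m = 0 ↔ m = k := by rw [sub_eq_zero, eq_comm]
  have h2 : -k - m = 0 ↔ m = -k := by rw [sub_eq_zero, eq_comm]
  simp only [h1, h2]

lemma integrable_mul_continuous (f : L2Torus d) {g : Torus d → ℂ} (hg : Continuous g) :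
    Integrable (fun x => (f x : ℂ) * g x) (torusMeasure d) := by
  obtain ⟨C, hC⟩ := isCompact_univ.exists_bound_of_continuousOn hg.continuousOn
  have hf : Integrable f (torusMeasure d) := (Lp.memLp f).integrable (by norm_num)
  exact hf.ofReal.mul_bdd (c := C) hg.aestronglyMeasurable (.of_forall fun x => hC x trivial)

lemma coeff_neg_index (f : L2Torus d) (k : Fin d → ℤ) : coeff f (-k) = conj (coeff f k) := by
  rw [coeff, coeff, ← integral_conj]
  refine integral_congr_ae (.of_forall fun x => ?_)
  simp [char_neg]

/-- Since f is real, its coefficient at -k is the conjugate of the one at k, and the coefficient has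
minus the sine integral as its imaginary part. -/
lemma integral_mul_casL (f : L2Torus d) (k : Fin d → ℤ) :
    ∫ x, f x * casL k x ∂(torusMeasure d) = (coeff f k).re - (coeff f k).im := by
  have h1 : ((∫ x, f x * casL k x ∂(torusMeasure d) : ℝ) : ℂ)
      = ((1 + Complex.I) * coeff f k + (1 - Complex.I) * coeff f (-k)) / 2 := by
    have e1 : ∫ x, (f x : ℂ) * conj (char k x) ∂(torusMeasure d) = coeff f k := rfl
    have e2 : ∫ x, (f x : ℂ) * conj (char (-k) x) ∂(torusMeasure d) = coeff f (-k) := rfl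
    rw [← integral_complex_ofReal, ← e1, ← e2, ← integral_const_mul, ← integral_const_mul,
      ← integral_add ((integrable_mul_continuous f (by fun_prop)).const_mul _)
        ((integrable_mul_continuous f (by fun_prop)).const_mul _), ← integral_div]
    refine integral_congr_ae ?_
    filter_upwards [casL_coeFn k] with x hx
    rw [hx, Complex.ofReal_mul, ofReal_cas, char_neg, Complex.conj_conj]
    ring
  have h2 := congrArg Complex.re h1
  rw [coeff_neg_index, Complex.ofReal_re] at h2
  rw [h2]
  simp

/-- The cas functions form a real orthonormal system indexed by all of ℤ^d, with no separate
treatment of sines, cosines or k = 0: in re - im of the coefficient, (1-i)/2 at k contributes 1 and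
(1+i)/2 at -k contributes 0. -/
lemma integral_casL_mul_casL (k l : Fin d → ℤ) :
    ∫ x, casL k x * casL l x ∂(torusMeasure d) = if k = l then 1 else 0 := by
  rw [integral_mul_casL, coeff_casL]
  have h1 : l = k ↔ k = l := eq_comm
  simp only [h1]
  split_ifs <;> norm_num

lemma inner_L2Torus (f g : L2Torus d) : inner ℝ f g = ∫ x, f x * g x ∂(torusMeasure d) := by
  rw [MeasureTheory.L2.inner_def]
  exact integral_congr_ae (.of_forall fun x => by simp [RCLike.inner_apply, mul_comm])

/-- The conditions at k and -k say that re - im and re + im of the coefficient vanish; Parseval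
concludes. -/
lemma eq_zero_of_forall_integral_casL (f : L2Torus d)
    (h : ∀ k, ∫ x, f x * casL k x ∂(torusMeasure d) = 0) : f = 0 := by
  have h0 : ∀ k, coeff f k = 0 := fun k => by
    have h1 := h k
    have h2 := h (-k)
    rw [integral_mul_casL] at h1 h2
    rw [coeff_neg_index, Complex.conj_re, Complex.conj_im] at h2
    apply Complex.ext <;> simp <;> linarith
  have := (hasSum_coeff f f).tsum_eq
  simp only [h0, zero_mul, Complex.zero_re, tsum_zero] at this
  rw [← inner_L2Torus] at this
  exact inner_self_eq_zero.1 this.symm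

lemma span_casL_closure (d : ℕ) :
    (Submodule.span ℝ (Set.range (casL (d := d)))).topologicalClosure = ⊤ := by
  rw [Submodule.topologicalClosure_eq_top_iff, Submodule.eq_bot_iff]
  intro f hf
  refine eq_zero_of_forall_integral_casL f fun k => ?_
  rw [← inner_L2Torus, real_inner_comm]
  exact (Submodule.mem_orthogonal _ _).1 hf _ (Submodule.subset_span ⟨k, rfl⟩)

/-! ### An orthonormal basis of `H_{-J}` -/

variable (J : ℝ≥0)

lemma norm_toNeg_le (f : L2Torus d) : ‖toNeg J f‖ ≤ ‖f‖ := by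
  rw [← sq_le_sq₀ (norm_nonneg _) (norm_nonneg _), norm_sq_toNeg, ← real_inner_self_eq_norm_sq f,
    inner_L2Torus]
  have hs := hasSum_coeff f f
  simp only [Complex.mul_conj, Complex.ofReal_re, Complex.normSq_eq_norm_sq] at hs
  rw [← hs.tsum_eq]
  have hle : ∀ k : Fin d → ℤ, weight k ^ (-(J : ℝ)) * ‖coeff f k‖ ^ 2 ≤ ‖coeff f k‖ ^ 2 :=
    fun k => mul_le_of_le_one_left (sq_nonneg _)
      (Real.rpow_le_one_of_one_le_of_nonpos (one_le_weight k) (by simp))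
  exact (hs.summable.of_nonneg_of_le
    (fun k => mul_nonneg (Real.rpow_nonneg (weight_pos k).le _) (sq_nonneg _)) hle).tsum_le_tsum
    hle hs.summable

lemma continuous_toNeg : Continuous (toNeg (d := d) J) :=
  AddMonoidHomClass.continuous_of_bound (toNeg (d := d) J) 1 fun f => by
    simpa using norm_toNeg_le J f

/-- Required by the convolution arguments in H_{-J}. Separability passes from L₂ through the
continuous embedding with dense range. -/
instance : SecondCountableTopology (NegSobolev d J) := by
  have : Fact ((2 : ℝ≥0∞) ≠ ∞) := ⟨by norm_num⟩
  have : TopologicalSpace.SeparableSpace (NegSobolev d J) :=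
    (denseRange_toNeg d J).separableSpace (continuous_toNeg J)
  exact UniformSpace.secondCountable_of_separable _

lemma inner_toNeg (f g : L2Torus d) : inner ℝ (toNeg J f) (toNeg J g) =
    ∑' k : Fin d → ℤ, weight k ^ (-(J : ℝ)) * (coeff f k * conj (coeff g k)).re := by
  change inner ℝ ((toPre J f : PreNegSobolev d J) : NegSobolev d J)
    ((toPre J g : PreNegSobolev d J) : NegSobolev d J) = _
  rw [UniformSpace.Completion.inner_coe]
  rfl

lemma weight_neg (k : Fin d → ℤ) : weight (-k) = weight k := by simp [weight]

/-- The only frequencies of cas(k·x) are k and -k, where the weight takes the same value, so it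
factors out of the sum. -/
lemma inner_toNeg_casL (f : L2Torus d) (k : Fin d → ℤ) :
    inner ℝ (toNeg J (casL k)) (toNeg J f) =
      weight k ^ (-(J : ℝ)) * ∫ x, f x * casL k x ∂(torusMeasure d) := by
  have e : ∫ x, f x * casL k x ∂(torusMeasure d) = ∫ x, casL k x * f x ∂(torusMeasure d) := by
    simp only [mul_comm]
  rw [e, ← (hasSum_coeff (casL k) f).tsum_eq, inner_toNeg, ← tsum_mul_left]
  refine tsum_congr fun m => ?_
  by_cases h1 : m = k
  · rw [h1]
  by_cases h2 : m = -k
  · rw [h2, weight_neg]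
  simp [coeff_casL, h1, h2]

/-- The vectors `(1 + |k|²)^{J/2} cas (k·x)` of `H_{-J}`. -/
def negBasisVec (k : Fin d → ℤ) : NegSobolev d J := weight k ^ ((J : ℝ) / 2) • toNeg J (casL k)

lemma inner_negBasisVec_toNeg (k : Fin d → ℤ) (f : L2Torus d) :
    inner ℝ (negBasisVec J k) (toNeg J f) =
      weight k ^ (-((J : ℝ) / 2)) * ∫ x, f x * casL k x ∂(torusMeasure d) := by
  rw [negBasisVec, real_inner_smul_left, inner_toNeg_casL, ← mul_assoc,
    ← Real.rpow_add (weight_pos k)]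
  congr 2; ring

lemma orthonormal_negBasisVec : Orthonormal ℝ (negBasisVec (d := d) J) := by
  rw [orthonormal_iff_ite]
  intro k l
  conv_lhs => rw [negBasisVec.eq_def J l, real_inner_smul_right, inner_negBasisVec_toNeg,
    integral_casL_mul_casL]
  by_cases h : k = l
  · subst h
    rw [if_pos rfl, mul_one, ← Real.rpow_add (weight_pos k), add_neg_cancel,
      Real.rpow_zero]
  · rw [if_neg h, if_neg (Ne.symm h), mul_zero, mul_zero]

/-- The orthonormal basis `(1 + |k|²)^{J/2} cas (k·x)` of `H_{-J}`. -/
def negBasis : HilbertBasis (Fin d → ℤ) ℝ (NegSobolev d J) :=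
  HilbertBasis.mk (orthonormal_negBasisVec J) (by
    set V := (Submodule.span ℝ (Set.range (negBasisVec (d := d) J))).topologicalClosure with hV
    let T : L2Torus d →L[ℝ] NegSobolev d J := ⟨toNeg J, continuous_toNeg J⟩
    -- The preimage of the closed span V under the embedding is closed and contains all cas
    -- functions, hence all of L₂; density of L₂ in H_{-J} then gives V everything.
    have h1 : Submodule.span ℝ (Set.range (casL (d := d))) ≤ V.comap T.toLinearMap := by
      rw [Submodule.span_le]
      rintro _ ⟨k, rfl⟩
      have e : toNeg J (casL k) = (weight k ^ ((J : ℝ) / 2))⁻¹ • negBasisVec J k := by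
        rw [negBasisVec, smul_smul, inv_mul_cancel₀ (Real.rpow_pos_of_pos (weight_pos k) _).ne',
          one_smul]
      change toNeg J (casL k) ∈ V
      rw [e]
      exact V.smul_mem _ (Submodule.le_topologicalClosure _ (Submodule.subset_span ⟨k, rfl⟩))
    have hc : IsClosed (V.comap T.toLinearMap : Set (L2Torus d)) :=
      (Submodule.isClosed_topologicalClosure _).preimage T.continuous
    have h2 := Submodule.topologicalClosure_minimal _ h1 hc
    rw [span_casL_closure] at h2
    have h3 : Set.range (toNeg (d := d) J) ⊆ V := by
      rintro _ ⟨f, rfl⟩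
      exact h2 (Submodule.mem_top (x := f))
    intro x _
    exact (closure_minimal h3 (Submodule.isClosed_topologicalClosure _))
      (denseRange_toNeg d J x))

lemma negBasis_apply (k : Fin d → ℤ) : negBasis J k = negBasisVec J k :=
  congrFun (HilbertBasis.coe_mk _ _) k

lemma memSobolev_casL (k : Fin d → ℤ) : MemSobolev J (casL k) := by
  refine summable_of_ne_finset_zero (s := {k, -k}) fun m hm => ?_
  simp only [Finset.mem_insert, Finset.mem_singleton, not_or] at hm
  simp [coeff_casL, hm.1, hm.2]

/-- Both sides are continuous in z and agree on the dense image of L₂. This expresses basis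
coordinates by the pairings in which the covariance of ζ is prescribed. -/
lemma inner_negBasis (k : Fin d → ℤ) (z : NegSobolev d J) :
    inner ℝ (negBasis J k) z = weight k ^ (-((J : ℝ) / 2)) * pairing J (casL k) z := by
  revert z
  rw [← funext_iff]
  refine (denseRange_toNeg d J).equalizer (by fun_prop) (by fun_prop) (funext fun f => ?_)
  simp only [Function.comp_apply]
  rw [negBasis_apply, inner_negBasisVec_toNeg, pairing_toNeg (memSobolev_casL J k)]

lemma inner_negBasis_toNeg (k : Fin d → ℤ) (f : L2Torus d) :
    inner ℝ (negBasis J k) (toNeg J f) =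
      weight k ^ (-((J : ℝ) / 2)) * ∫ x, f x * casL k x ∂(torusMeasure d) := by
  rw [negBasis_apply, inner_negBasisVec_toNeg]

end TrigBasis

section Torus

variable {d : ℕ}

/-! ### Summability of the weights -/

lemma norm_sq_le_weight (k : Fin d → ℤ) : ‖fun j => (k j : ℝ)‖ ^ 2 ≤ weight k := by
  have h : ‖fun j => (k j : ℝ)‖ ≤ √(weight k) := by
    refine (pi_norm_le_iff_of_nonneg (Real.sqrt_nonneg _)).2 fun j => ?_
    rw [Real.norm_eq_abs]
    refine Real.abs_le_sqrt ?_
    have := Finset.single_le_sum (f := fun j => (k j : ℝ) ^ 2) (fun i _ => sq_nonneg _)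
      (Finset.mem_univ j)
    unfold weight
    linarith
  calc _ ≤ √(weight k) ^ 2 := by gcongr
    _ = _ := Real.sq_sqrt (weight_pos k).le

/-- Comparison with ∑ ‖k‖^{-2s} over the lattice ℤ^d of rank d, in the sup norm, which converges for
2s > d. -/
lemma summable_weight_rpow {s : ℝ} (hs : (d : ℝ) / 2 < s) :
    Summable fun k : Fin d → ℤ => weight k ^ (-s) := by
  set L : Submodule ℤ (Fin d → ℝ) := Submodule.span ℤ (Set.range (Pi.basisFun ℝ (Fin d))) with hL
  have hs0 : 0 < s := lt_of_le_of_lt (by positivity) hs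
  have hr : (-(2 * s)) < -(Module.finrank ℤ L : ℝ) := by
    rw [ZLattice.rank ℝ L, Module.finrank_fin_fun]
    linarith
  have hmem : ∀ k : Fin d → ℤ, (fun j => (k j : ℝ)) ∈ L := fun k => by
    have e : (fun j => (k j : ℝ)) = ∑ j, k j • (Pi.basisFun ℝ (Fin d)) j := by
      ext i
      simp [Finset.sum_apply, Pi.single_apply]
    rw [e]
    exact Submodule.sum_mem _ fun j _ => Submodule.smul_mem _ _ (Submodule.subset_span ⟨j, rfl⟩)
  have hinj : Function.Injective fun k : Fin d → ℤ => (⟨_, hmem k⟩ : L) := fun k l h => by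
    ext j
    have : (k j : ℝ) = l j := congrFun (Subtype.ext_iff.1 h) j
    exact_mod_cast this
  have h1 := (ZLattice.summable_norm_rpow L _ hr).comp_injective hinj
  -- The comparison fails at the origin, so the indicator of 0 is added to the majorant.
  have h2 : Summable fun k : Fin d → ℤ => if k = 0 then (1 : ℝ) else 0 :=
    summable_of_ne_finset_zero (s := {0}) fun k hk => if_neg (by simpa using hk)
  refine (h1.add h2).of_nonneg_of_le (fun k => Real.rpow_nonneg (weight_pos k).le _) fun k => ?_
  by_cases hk : k = 0
  · rw [if_pos hk]
    have := Real.rpow_le_one_of_one_le_of_nonpos (one_le_weight k) (neg_nonpos.2 hs0.le)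
    have h0 : 0 ≤ ‖(⟨_, hmem k⟩ : L)‖ ^ (-(2 * s)) := Real.rpow_nonneg (norm_nonneg _) _
    simp only [Function.comp_apply]
    linarith
  · rw [if_neg hk, add_zero]
    have hpos : 0 < ‖fun j => (k j : ℝ)‖ := by
      rw [norm_pos_iff]
      intro h
      apply hk
      ext j
      have := congrFun h j
      simpa using this
    change _ ≤ ‖fun j => (k j : ℝ)‖ ^ (-(2 * s))
    rw [show -(2 * s) = 2 * (-s) by ring, Real.rpow_mul hpos.le, Real.rpow_two]
    exact Real.rpow_le_rpow_of_nonpos (by positivity) (norm_sq_le_weight k) (neg_nonpos.2 hs0.le)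

lemma abs_coord_le_sqrt_weight (k : Fin d → ℤ) (j : Fin d) : |(k j : ℝ)| ≤ √(weight k) := by
  refine Real.le_sqrt_of_sq_le (le_trans ?_ (norm_sq_le_weight k))
  gcongr
  exact norm_le_pi_norm (fun j => (k j : ℝ)) j

/-! ### Functions on the torus as periodic functions -/

/-- The projection `ℝ^d → 𝕋^d`. -/
def proj (s : Fin d → ℝ) : Torus d := fun j => ((s j : ℝ) : AddCircle (2 * Real.pi))

lemma proj_add (s t : Fin d → ℝ) : proj (s + t) = proj s + proj t := by
  ext j; simp [proj]

lemma isOpenQuotientMap_proj : IsOpenQuotientMap (proj (d := d)) :=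
  IsOpenQuotientMap.piMap (f := fun _ (s : ℝ) => (s : AddCircle (2 * Real.pi)))
    fun _ => QuotientAddGroup.isOpenQuotientMap_mk

lemma char_proj (k : Fin d → ℤ) (s : Fin d → ℝ) :
    char k (proj s) = Complex.exp ((∑ j, (k j : ℝ) * s j : ℝ) * Complex.I) := by
  simp only [char, ContinuousMap.coe_mk, proj, fourier_coe_apply]
  rw [← Complex.exp_sum]
  congr 1
  push_cast
  rw [Finset.sum_mul]
  refine Finset.sum_congr rfl fun j _ => ?_
  have : (Real.pi : ℂ) ≠ 0 := by exact_mod_cast Real.pi_ne_zero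
  field_simp

lemma cas_proj (k : Fin d → ℤ) (s : Fin d → ℝ) :
    cas k (proj s) = Real.cos (∑ j, (k j : ℝ) * s j) + Real.sin (∑ j, (k j : ℝ) * s j) := by
  rw [cas_apply, char_proj, Complex.exp_ofReal_mul_I_re, Complex.exp_ofReal_mul_I_im]

/-- The phase k·s moves by at most d · h · √weight(k); cosine and sine are each 1-Lipschitz, whence
the factor 2. -/
lemma abs_cas_proj_add_sub_le (k : Fin d → ℤ) (s t : Fin d → ℝ) {h : ℝ} (ht : ∀ j, |t j| ≤ h) :
    |cas k (proj (s + t)) - cas k (proj s)| ≤ 2 * (d * h) * √(weight k) := by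
  have e : (∑ j, (k j : ℝ) * (s + t) j) - ∑ j, (k j : ℝ) * s j = ∑ j, (k j : ℝ) * t j := by
    rw [← Finset.sum_sub_distrib]
    exact Finset.sum_congr rfl fun j _ => by simp; ring
  have h1 : |∑ j, (k j : ℝ) * t j| ≤ d * h * √(weight k) := by
    refine (Finset.abs_sum_le_sum_abs _ _).trans ?_
    calc ∑ j, |(k j : ℝ) * t j| ≤ ∑ _j : Fin d, √(weight k) * h := Finset.sum_le_sum fun j _ => by
          rw [abs_mul]
          exact mul_le_mul (abs_coord_le_sqrt_weight k j) (ht j) (abs_nonneg _)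
            (Real.sqrt_nonneg _)
      _ = _ := by simp; ring
  have hc := Real.abs_cos_sub_cos_le (∑ j, (k j : ℝ) * (s + t) j) (∑ j, (k j : ℝ) * s j)
  have hs := Real.abs_sin_sub_sin_le (∑ j, (k j : ℝ) * (s + t) j) (∑ j, (k j : ℝ) * s j)
  rw [e] at hc hs
  rw [cas_proj, cas_proj]
  calc _ = |(Real.cos (∑ j, (k j : ℝ) * (s + t) j) - Real.cos (∑ j, (k j : ℝ) * s j)) +
        (Real.sin (∑ j, (k j : ℝ) * (s + t) j) - Real.sin (∑ j, (k j : ℝ) * s j))| := by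
        congr 1; ring
    _ ≤ _ := (abs_add_le _ _).trans (by linarith)

lemma lift_toLp (ρ : Torus d → ℝ) (s : Fin d → ℝ) : lift ρ (WithLp.toLp 2 s) = ρ (proj s) := rfl

lemma IsC1.continuous {ρ : Torus d → ℝ} (hρ : IsC1 ρ) : Continuous ρ := by
  rw [isOpenQuotientMap_proj.isQuotientMap.continuous_iff]
  exact (ContDiff.continuous hρ).comp (PiLp.continuous_toLp 2 _)

lemma norm_gradient_eq (f : EuclideanSpace ℝ (Fin d) → ℝ) (y : EuclideanSpace ℝ (Fin d)) :
    ‖gradient f y‖ = ‖fderiv ℝ f y‖ := by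
  rw [gradient, LinearIsometryEquiv.norm_map]

/-- Boundedness makes the real supremum `gradNorm` an actual upper bound. By periodicity the
gradient is determined by its values on [0, 2π)^d, which lies in a compact ball. -/
lemma bddAbove_norm_gradient {ρ : Torus d → ℝ} (hρ : IsC1 ρ) :
    BddAbove (Set.range fun y => ‖gradient (lift ρ) y‖) := by
  simp only [norm_gradient_eq]
  have hc : Continuous (fderiv ℝ (lift ρ)) := ContDiff.continuous_fderiv hρ one_ne_zero
  obtain ⟨C, hC⟩ := (isCompact_closedBall (0 : EuclideanSpace ℝ (Fin d))
    (√(d * (2 * Real.pi) ^ 2))).exists_bound_of_continuousOn hc.continuousOn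
  refine ⟨C, ?_⟩
  rintro _ ⟨y, rfl⟩
  set y' : EuclideanSpace ℝ (Fin d) :=
    WithLp.toLp 2 fun j => toIcoMod Real.two_pi_pos 0 (y j) with hy'
  have hmem : y' ∈ Metric.closedBall (0 : EuclideanSpace ℝ (Fin d))
      (√(d * (2 * Real.pi) ^ 2)) := by
    rw [mem_closedBall_zero_iff, EuclideanSpace.norm_eq]
    refine Real.sqrt_le_sqrt ?_
    calc ∑ i, ‖y' i‖ ^ 2 ≤ ∑ _i : Fin d, (2 * Real.pi) ^ 2 := Finset.sum_le_sum fun i _ => by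
          have h := toIcoMod_mem_Ico Real.two_pi_pos 0 (y i)
          have : ‖y' i‖ ≤ 2 * Real.pi := by
            rw [Real.norm_eq_abs, abs_of_nonneg h.1]
            simpa using h.2.le
          gcongr
      _ = _ := by simp
  have hper : lift ρ = fun z => lift ρ (z + (y - y')) := by
    ext z
    change ρ _ = ρ _
    congr 1
    ext j
    have h := self_sub_toIcoMod Real.two_pi_pos 0 (y j)
    have : (z + (y - y')) j = z j + toIcoDiv Real.two_pi_pos 0 (y j) • (2 * Real.pi) := by
      rw [← h]; simp [hy']
    rw [this, AddCircle.coe_add, AddCircle.coe_zsmul, AddCircle.coe_period, smul_zero, add_zero]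
  have hfd : fderiv ℝ (lift ρ) y' = fderiv ℝ (lift ρ) y := by
    conv_lhs => rw [hper, fderiv_comp_add_right]
    congr 1
    abel
  simp only
  rw [← hfd]
  exact hC y' hmem

lemma gradNorm_nonneg (ρ : Torus d → ℝ) : 0 ≤ gradNorm ρ := Real.iSup_nonneg fun _ => norm_nonneg _

lemma abs_proj_add_sub_le {ρ : Torus d → ℝ} (hρ : IsC1 ρ) (s t : Fin d → ℝ) {h : ℝ}
    (hh : 0 ≤ h) (ht : ∀ j, |t j| ≤ h) :
    |ρ (proj (s + t)) - ρ (proj s)| ≤ d * h * gradNorm ρ := by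
  have h1 := convex_univ.norm_image_sub_le_of_norm_fderiv_le (𝕜 := ℝ) (f := lift ρ)
    (C := gradNorm ρ) (fun y _ => (ContDiff.differentiable hρ one_ne_zero) y)
    (fun y _ => by
      rw [← norm_gradient_eq]
      exact le_ciSup (bddAbove_norm_gradient hρ) y)
    (Set.mem_univ (WithLp.toLp 2 s)) (Set.mem_univ (WithLp.toLp 2 (s + t)))
  rw [lift_toLp, lift_toLp, Real.norm_eq_abs, ← WithLp.toLp_sub, add_sub_cancel_left] at h1
  have h2 : ‖(WithLp.toLp 2 t : EuclideanSpace ℝ (Fin d))‖ ≤ d * h := by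
    rw [EuclideanSpace.norm_eq]
    refine Real.sqrt_le_iff.2 ⟨by positivity, ?_⟩
    calc ∑ i, ‖t i‖ ^ 2 ≤ ∑ _i : Fin d, h ^ 2 := Finset.sum_le_sum fun i _ => by
          have := ht i
          rw [Real.norm_eq_abs]
          gcongr
      _ = d * h ^ 2 := by simp
      _ ≤ (d * h) ^ 2 := by
        rw [mul_pow]
        gcongr
        exact_mod_cast Nat.le_self_pow two_ne_zero d
  calc _ ≤ gradNorm ρ * ‖(WithLp.toLp 2 t : EuclideanSpace ℝ (Fin d))‖ := h1
    _ ≤ gradNorm ρ * (d * h) := by gcongr; exact gradNorm_nonneg ρ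
    _ = _ := mul_comm _ _

/-! ### Riemann sums over the discrete torus -/

variable {n : ℕ}

lemma card_idx : (Fintype.card (Idx d n) : ℝ) = (2 * n + 1) ^ d := by
  rw [Fintype.card_fun, Fintype.card_fin, Fintype.card_coe, Int.card_Icc,
    show (n : ℤ) + 1 - -n = ((2 * n + 1 : ℕ) : ℤ) by push_cast; ring, Int.toNat_natCast]
  push_cast
  rfl

lemma exists_site_eq (m : Fin d → ℤ) :
    ∃ x : Idx d n, site x = proj fun j => 2 * Real.pi * m j / (2 * n + 1) := by
  -- The balanced residue of `m j` modulo 2n+1, with values in {-n, …, n}.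
  have hb : ∀ j, (m j + n) % (2 * n + 1) - n ∈ Finset.Icc (-(n : ℤ)) (n : ℤ) := fun j => by
    have h1 := Int.emod_nonneg (m j + n) (b := 2 * n + 1) (by omega)
    have h2 := Int.emod_lt_of_pos (m j + n) (b := 2 * n + 1) (by omega)
    rw [Finset.mem_Icc]
    omega
  refine ⟨fun j => ⟨_, hb j⟩, ?_⟩
  ext j
  have h3 := Int.emod_add_mul_ediv (m j + n) (2 * n + 1)
  have h4 : (((m j + n) % (2 * n + 1) - n : ℤ) : ℝ)
      = m j - (2 * n + 1) * ((m j + n) / (2 * n + 1) : ℤ) := by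
    have : (m j + n) % (2 * n + 1) - n = m j - (2 * n + 1) * ((m j + n) / (2 * n + 1)) := by omega
    rw [this]
    push_cast
    ring
  have hn : (2 * n + 1 : ℝ) ≠ 0 := by positivity
  simp only [site, freq, proj]
  rw [h4, ← sub_eq_zero, ← AddCircle.coe_sub, AddCircle.coe_eq_zero_iff]
  refine ⟨-((m j + n) / (2 * n + 1)), ?_⟩
  simp only [zsmul_eq_mul]
  push_cast
  field_simp
  ring

lemma site_injective : Function.Injective (site (d := d) (n := n)) := fun x y h => by
  funext j
  have hj := congrFun h j
  simp only [site] at hj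
  rw [← sub_eq_zero, ← AddCircle.coe_sub, AddCircle.coe_eq_zero_iff] at hj
  obtain ⟨z, hz⟩ := hj
  have hn : (2 * n + 1 : ℝ) ≠ 0 := by positivity
  have h1 : (freq x j : ℝ) - freq y j = z * (2 * n + 1) := by
    rw [zsmul_eq_mul] at hz
    field_simp at hz
    linarith
  have h2 : freq x j - freq y j = z * (2 * n + 1) := by exact_mod_cast h1
  have hx := Finset.mem_Icc.1 (x j).2
  have hy := Finset.mem_Icc.1 (y j).2
  simp only [freq] at h2
  have hz0 : z = 0 := by
    by_contra hne
    rcases lt_or_gt_of_ne hne with h | h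
    · nlinarith
    · nlinarith
  rw [hz0, zero_mul] at h2
  exact Subtype.ext (by omega)

/-- The discrete torus is a subgroup of the torus, so translation by one of its points permutes it.
-/
lemma sum_site_add (g : Torus d → ℝ) (x₀ : Idx d n) (y : Torus d) :
    ∑ x : Idx d n, g (site x + (site x₀ + y)) = ∑ x : Idx d n, g (site x + y) := by
  have h : ∀ x : Idx d n, ∃ x', site (n := n) x' = site x + site x₀ := fun x => by
    obtain ⟨x', hx'⟩ := exists_site_eq (n := n) (freq x + freq x₀)
    refine ⟨x', hx'.trans ?_⟩
    ext j
    simp only [proj, site, Pi.add_apply, ← AddCircle.coe_add]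
    congr 1
    push_cast
    ring
  choose φ hφ using h
  have hinj : Function.Injective φ := fun x x' hx => by
    have := hφ x
    rw [hx, hφ x', add_left_inj] at this
    exact (site_injective this).symm
  rw [← (Finite.injective_iff_bijective.1 hinj).sum_comp fun x => g (site x + y)]
  refine Finset.sum_congr rfl fun x _ => ?_
  rw [hφ, add_assoc]

/-- Rounding to the nearest grid point; the offset is at most half the mesh 2π/(2n+1) in each
coordinate. -/
lemma exists_site_add_proj (y : Torus d) : ∃ (x₀ : Idx d n) (t : Fin d → ℝ),
    (∀ j, |t j| ≤ Real.pi / (2 * n + 1)) ∧ y = site x₀ + proj t := by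
  obtain ⟨u, rfl⟩ := isOpenQuotientMap_proj.surjective y
  have hn : (0 : ℝ) < 2 * n + 1 := by positivity
  set m : Fin d → ℤ := fun j => round (u j * (2 * n + 1) / (2 * Real.pi)) with hm
  obtain ⟨x₀, hx₀⟩ := exists_site_eq (n := n) m
  refine ⟨x₀, fun j => u j - 2 * Real.pi * m j / (2 * n + 1), fun j => ?_, ?_⟩
  · have h := abs_sub_round (u j * (2 * n + 1) / (2 * Real.pi))
    have e : u j - 2 * Real.pi * m j / (2 * n + 1) = 2 * Real.pi / (2 * n + 1) *
        (u j * (2 * n + 1) / (2 * Real.pi) - m j) := by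
      field_simp
    simp only
    rw [e, abs_mul, abs_of_pos (by positivity)]
    calc _ ≤ 2 * Real.pi / (2 * n + 1) * (1 / 2) := by gcongr
      _ = _ := by ring
  · rw [hx₀, ← proj_add]
    congr 1
    ext j
    simp

/-- Let A(y) be the average of g over the grid shifted by y. Haar invariance gives ∫ A = ∫ g, while
A(0) is the Riemann sum. By grid invariance A(y) depends only on the offset of y from a nearby grid
point, so |A(0) - A(y)| ≤ η. No partition into cells is needed. -/
lemma abs_riemannSum_sub_integral_le {g : Torus d → ℝ} (hg : Continuous g) {η : ℝ}
    (h : ∀ s t : Fin d → ℝ, (∀ j, |t j| ≤ Real.pi / (2 * n + 1)) →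
      |g (proj (s + t)) - g (proj s)| ≤ η) :
    |((2 * n + 1 : ℝ) ^ d)⁻¹ * ∑ x : Idx d n, g (site x) - ∫ y, g y ∂(torusMeasure d)| ≤ η := by
  have hN : (0 : ℝ) < (2 * n + 1) ^ d := by positivity
  set A : Torus d → ℝ := fun y => ((2 * n + 1 : ℝ) ^ d)⁻¹ * ∑ x : Idx d n, g (site x + y) with hA
  have hAc : Continuous A := by fun_prop
  have hint : ∫ y, A y ∂(torusMeasure d) = ∫ y, g y ∂(torusMeasure d) := by
    have hinv : (torusMeasure d).IsAddLeftInvariant := by unfold torusMeasure; infer_instance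
    rw [integral_const_mul, integral_finsetSum _ fun x _ => integrable_of_continuous (by fun_prop)]
    simp only [integral_add_left_eq_self]
    rw [Finset.sum_const, Finset.card_univ, nsmul_eq_mul, card_idx, inv_mul_cancel_left₀ hN.ne']
  have hdiff : ∀ y, |A 0 - A y| ≤ η := fun y => by
    obtain ⟨x₀, t, ht, rfl⟩ := exists_site_add_proj (n := n) y
    simp only [hA, sum_site_add, add_zero]
    rw [← mul_sub, ← Finset.sum_sub_distrib, abs_mul, abs_of_pos (inv_pos.2 hN)]
    calc _ ≤ ((2 * n + 1 : ℝ) ^ d)⁻¹ * ∑ _x : Idx d n, η := by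
          gcongr
          refine (Finset.abs_sum_le_sum_abs _ _).trans (Finset.sum_le_sum fun x _ => ?_)
          rw [abs_sub_comm]
          have := h (fun j => 2 * Real.pi * (freq x j : ℝ) / (2 * n + 1)) t ht
          rwa [proj_add] at this
      _ = η := by
        rw [Finset.sum_const, Finset.card_univ, nsmul_eq_mul, card_idx, inv_mul_cancel_left₀ hN.ne']
  have e : ((2 * n + 1 : ℝ) ^ d)⁻¹ * ∑ x : Idx d n, g (site x) = ∫ _y, A 0 ∂(torusMeasure d) := by
    simp [hA]
  rw [e, ← hint, ← integral_sub (integrable_const _) (integrable_of_continuous hAc)]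
  refine (norm_integral_le_of_norm_le_const (μ := torusMeasure d) (C := η)
    (f := fun y => A 0 - A y) (.of_forall hdiff)).trans ?_
  simp

end Torus

section Extension

variable {d n : ℕ}

/-! ### The extension operator in the trigonometric basis -/

/-- The index `-k`. -/
def negIdx (k : Idx d n) : Idx d n := fun j => ⟨-(k j : ℤ), by
  have := Finset.mem_Icc.1 (k j).2
  exact Finset.mem_Icc.2 ⟨by omega, by omega⟩⟩

lemma freq_negIdx (k : Idx d n) : freq (negIdx k) = -freq k := rfl

lemma negIdx_negIdx (k : Idx d n) : negIdx (negIdx k) = k := by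
  funext j
  exact Subtype.ext (neg_neg _)

lemma freq_injective : Function.Injective (freq (d := d) (n := n)) := fun k l h => by
  funext j
  exact Subtype.ext (congrFun h j)

lemma discCoeff_negIdx (f : Idx d n → ℝ) (k : Idx d n) :
    discCoeff f (negIdx k) = conj (discCoeff f k) := by
  simp [discCoeff, freq_negIdx, char_neg, Complex.conj_ofNat]

lemma ofReal_ex (f : Idx d n → ℝ) (y : Torus d) :
    (ex f y : ℂ) = ∑ k, discCoeff f k * char (freq k) y := by
  refine Complex.conj_eq_iff_re.1 ?_
  rw [map_sum, ← Equiv.sum_comp (Function.Involutive.toPerm negIdx negIdx_negIdx)]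
  refine Finset.sum_congr rfl fun k _ => ?_
  change conj (discCoeff f (negIdx k) * char (freq (negIdx k)) y) = _
  rw [discCoeff_negIdx, freq_negIdx, char_neg, map_mul, Complex.conj_conj, Complex.conj_conj]

/-- `ex_n f` as an element of `L₂(𝕋^d)`. -/
def exL (f : Idx d n → ℝ) : L2Torus d := ContinuousMap.toLp (E := ℝ) 2 (torusMeasure d) ℝ (ex f)

lemma coeff_exL (f : Idx d n → ℝ) (m : Fin d → ℤ) :
    coeff (exL f) m = ∑ k, discCoeff f k * if freq k = m then 1 else 0 := by
  have e : coeff (exL f) m = ∫ x, ∑ k, discCoeff f k * char (freq k - m) x ∂(torusMeasure d) := by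
    refine integral_congr_ae ?_
    filter_upwards [ContinuousMap.coeFn_toLp (𝕜 := ℝ) (p := 2) (torusMeasure d) (ex f)] with x hx
    rw [exL, hx, ofReal_ex, Finset.sum_mul]
    refine Finset.sum_congr rfl fun k _ => ?_
    rw [sub_eq_add_neg, char_add, char_neg, mul_assoc]
  rw [e, integral_finsetSum _ fun k _ => (integrable_of_continuous (map_continuous _)).const_mul _]
  refine Finset.sum_congr rfl fun k _ => ?_
  rw [integral_const_mul, integral_char]
  simp only [sub_eq_zero]

lemma integral_exL_mul_casL (f : Idx d n → ℝ) (k : Idx d n) :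
    ∫ y, exL f y * casL (freq k) y ∂(torusMeasure d) =
      ((2 * n + 1 : ℝ) ^ d)⁻¹ * ∑ x, f x * cas (freq k) (site x) := by
  have h : coeff (exL f) (freq k) = discCoeff f k := by
    simp [coeff_exL, freq_injective.eq_iff]
  have h2 : discCoeff f k = (((2 * n + 1 : ℝ) ^ d)⁻¹ : ℝ) *
      ∑ x, (f x : ℂ) * conj (char (freq k) (site x)) := by
    rw [discCoeff]; push_cast; rfl
  rw [integral_mul_casL, h, h2, Complex.re_ofReal_mul, Complex.im_ofReal_mul, Complex.re_sum,
    Complex.im_sum, ← mul_sub, ← Finset.sum_sub_distrib]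
  congr 1
  refine Finset.sum_congr rfl fun x _ => ?_
  rw [Complex.re_ofReal_mul, Complex.im_ofReal_mul, Complex.conj_re, Complex.conj_im, cas_apply]
  ring

lemma integral_exL_mul_casL_of_notMem (f : Idx d n → ℝ) {m : Fin d → ℤ}
    (hm : m ∉ Set.range (freq (d := d) (n := n))) :
    ∫ y, exL f y * casL m y ∂(torusMeasure d) = 0 := by
  have h : coeff (exL f) m = 0 := by
    rw [coeff_exL]
    refine Finset.sum_eq_zero fun k _ => ?_
    rw [if_neg fun h => hm ⟨k, h⟩, mul_zero]
  rw [integral_mul_casL, h]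
  simp

/-- Lets the frequencies cut off by the extension operator be charged to the rate 1/n. -/
lemma sq_le_weight_of_notMem {m : Fin d → ℤ} (hm : m ∉ Set.range (freq (d := d) (n := n))) :
    (n : ℝ) ≤ √(weight m) := by
  obtain ⟨j, hj⟩ : ∃ j, m j ∉ Finset.Icc (-(n : ℤ)) n := by
    by_contra! h
    exact hm ⟨fun j => ⟨m j, h j⟩, rfl⟩
  refine le_trans ?_ (abs_coord_le_sqrt_weight m j)
  rw [Finset.mem_Icc, not_and_or, not_le, not_le] at hj
  have : (n : ℤ) ≤ |m j| := by
    rcases hj with h | h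
    · rw [abs_of_neg (by omega)]; omega
    · rw [abs_of_nonneg (by omega)]; omega
  exact_mod_cast this

lemma discCoeff_add (f g : Idx d n → ℝ) (k : Idx d n) :
    discCoeff (f + g) k = discCoeff f k + discCoeff g k := by
  simp only [discCoeff, ← mul_add, ← Finset.sum_add_distrib, Pi.add_apply, Complex.ofReal_add,
    add_mul]

lemma discCoeff_smul (c : ℝ) (f : Idx d n → ℝ) (k : Idx d n) :
    discCoeff (c • f) k = c * discCoeff f k := by
  simp only [discCoeff, Pi.smul_apply, smul_eq_mul, Complex.ofReal_mul, Finset.mul_sum]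
  exact Finset.sum_congr rfl fun x _ => by ring

/-- `exNeg` as a linear map. -/
def exNegLin (J : ℝ≥0) : (Idx d n → ℝ) →ₗ[ℝ] NegSobolev d J where
  toFun := exNeg J
  map_add' f g := by
    have h : ex (f + g) = ex f + ex g := by
      ext y
      simp only [ex, ContinuousMap.coe_mk, ContinuousMap.add_apply, discCoeff_add, add_mul,
        Finset.sum_add_distrib, Complex.add_re]
    rw [exNeg, h, map_add, map_add]
    rfl
  map_smul' c f := by
    have h : ex (c • f) = c • ex f := by
      ext y
      simp only [ex, ContinuousMap.coe_mk, ContinuousMap.smul_apply, discCoeff_smul, mul_assoc,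
        ← Finset.mul_sum, Complex.re_ofReal_mul, smul_eq_mul]
    rw [exNeg, h, map_smul, map_smul]
    rfl

/-- The contribution of a unit fluctuation at the site `x` to the rescaled fluctuation field. -/
def siteVec (J : ℝ≥0) (x : Idx d n) : NegSobolev d J :=
  exNeg J (Pi.single x ((2 * n + 1 : ℝ) ^ ((d : ℝ) / 2)))

/-- Linearity of the extension exhibits the field as a sum of independent scalars times
deterministic vectors, the setting of `TranslateClose.berryEsseen`. -/
lemma exNeg_fluctuation (J : ℝ≥0) (ρ : Idx d n → unitInterval) (η : Idx d n → Bool) :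
    exNeg J (fluctuation ρ η) = ∑ x, ((if η x then 1 else 0) - (ρ x : ℝ)) • siteVec J x := by
  have e : fluctuation ρ η = ∑ x, ((if η x then 1 else 0) - (ρ x : ℝ)) •
      (Pi.single x ((2 * n + 1 : ℝ) ^ ((d : ℝ) / 2)) : Idx d n → ℝ) := by
    ext y
    simp [fluctuation, Finset.sum_apply, Pi.single_apply, mul_comm]
  change exNegLin J _ = _
  rw [e, map_sum]
  refine Finset.sum_congr rfl fun x _ => ?_
  rw [map_smul]
  rfl

lemma inner_negBasis_siteVec (J : ℝ≥0) (k x : Idx d n) :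
    inner ℝ (negBasis J (freq k)) (siteVec J x) = weight (freq k) ^ (-((J : ℝ) / 2)) *
      (((2 * n + 1 : ℝ) ^ d)⁻¹ * ((2 * n + 1 : ℝ) ^ ((d : ℝ) / 2) * cas (freq k) (site x))) := by
  change inner ℝ _ (toNeg J (exL _)) = _
  rw [inner_negBasis_toNeg, integral_exL_mul_casL, Finset.sum_eq_single x]
  · rw [Pi.single_eq_same]
  · intro y _ hy
    rw [Pi.single_eq_of_ne hy, zero_mul]
  · simp

lemma inner_negBasis_siteVec_of_notMem (J : ℝ≥0) (x : Idx d n) {m : Fin d → ℤ}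
    (hm : m ∉ Set.range (freq (d := d) (n := n))) :
    inner ℝ (negBasis J m) (siteVec J x) = 0 := by
  change inner ℝ _ (toNeg J (exL _)) = _
  rw [inner_negBasis_toNeg, integral_exL_mul_casL_of_notMem _ hm, mul_zero]

lemma rpow_half_sq : ((2 * n + 1 : ℝ) ^ ((d : ℝ) / 2)) ^ 2 = (2 * n + 1 : ℝ) ^ d := by
  rw [← Real.rpow_natCast, ← Real.rpow_mul (by positivity), ← Real.rpow_natCast]
  congr 1
  push_cast
  ring

lemma rpow_half_pos : 0 < (2 * n + 1 : ℝ) ^ ((d : ℝ) / 2) := by positivity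

lemma weight_rpow_half_sq (k : Fin d → ℤ) (s : ℝ) : (weight k ^ (-(s / 2))) ^ 2 = weight k ^ (-s) := by
  rw [← Real.rpow_natCast, ← Real.rpow_mul (weight_pos k).le]
  congr 1
  push_cast
  ring

/-- Parseval in `negBasis`: since |cas| ≤ 2, each squared coordinate is at most 4 weight(k)^{-J} /
(2n+1)^d. -/
lemma norm_siteVec_le {J : ℝ≥0} (hJ : (d : ℝ) / 2 < J) (x : Idx d n) :
    ‖siteVec J x‖ ≤ 2 * √(∑' k : Fin d → ℤ, weight k ^ (-(J : ℝ))) /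
      (2 * n + 1 : ℝ) ^ ((d : ℝ) / 2) := by
  have hs := summable_weight_rpow hJ
  set c := (2 * n + 1 : ℝ) ^ ((d : ℝ) / 2) with hc
  have hc0 : 0 < c := rpow_half_pos
  have hc2 : (2 * n + 1 : ℝ) ^ d = c ^ 2 := rpow_half_sq.symm
  rw [← sq_le_sq₀ (norm_nonneg _) (by positivity)]
  have hp := (negBasis (d := d) J).hasSum_inner_mul_inner (siteVec J x) (siteVec J x)
  rw [real_inner_self_eq_norm_sq] at hp
  have hle : ∀ m : Fin d → ℤ, inner ℝ (siteVec J x) (negBasis J m) *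
      inner ℝ (negBasis J m) (siteVec J x) ≤ 4 / c ^ 2 * weight m ^ (-(J : ℝ)) := fun m => by
    rw [real_inner_comm, ← sq]
    by_cases hm : m ∈ Set.range (freq (d := d) (n := n))
    · obtain ⟨k, rfl⟩ := hm
      rw [inner_negBasis_siteVec, mul_pow, weight_rpow_half_sq, ← hc, hc2]
      have h1 : ((c ^ 2)⁻¹ * (c * cas (freq k) (site x))) ^ 2
          = cas (freq k) (site x) ^ 2 / c ^ 2 := by field_simp
      have h2 : cas (freq k) (site x) ^ 2 ≤ 4 := by
        rw [← sq_abs]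
        nlinarith [abs_cas_le (freq k) (site x), abs_nonneg (cas (freq k) (site x))]
      rw [h1, mul_comm]
      have := Real.rpow_nonneg (weight_pos (freq k)).le (-(J : ℝ))
      gcongr
    · rw [inner_negBasis_siteVec_of_notMem J x hm, zero_pow two_ne_zero]
      have := Real.rpow_nonneg (weight_pos m).le (-(J : ℝ))
      positivity
  rw [← hp.tsum_eq, div_pow, mul_pow, Real.sq_sqrt (tsum_nonneg fun k =>
    Real.rpow_nonneg (weight_pos k).le _)]
  refine (hp.summable.tsum_le_tsum hle (hs.mul_left _)).trans (le_of_eq ?_)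
  rw [tsum_mul_left]
  ring

/-! ### Comparison of covariances -/

lemma discNorm_bound (f : Idx d n → ℝ) :
    ((2 * n + 1 : ℝ) ^ d)⁻¹ * ∑ x, |f x| ≤ discNorm f := by
  have hN : (0 : ℝ) < (2 * n + 1) ^ d := by positivity
  refine Real.le_sqrt_of_sq_le ?_
  have h := sq_sum_le_card_mul_sum_sq (s := Finset.univ) (f := fun x : Idx d n => |f x|)
  rw [Finset.card_univ, card_idx] at h
  simp only [sq_abs] at h
  calc _ = (((2 * n + 1 : ℝ) ^ d)⁻¹) ^ 2 * (∑ x, |f x|) ^ 2 := mul_pow _ _ _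
    _ ≤ (((2 * n + 1 : ℝ) ^ d)⁻¹) ^ 2 * ((2 * n + 1 : ℝ) ^ d * ∑ x, f x ^ 2) := by gcongr
    _ = _ := by field_simp

lemma abs_mul_one_sub_sub_le {a b : ℝ} (ha : a ∈ Set.Icc (0 : ℝ) 1) (hb : b ∈ Set.Icc (0 : ℝ) 1) :
    |a * (1 - a) - b * (1 - b)| ≤ |a - b| := by
  have e : a * (1 - a) - b * (1 - b) = (a - b) * (1 - a - b) := by ring
  rw [e, abs_mul]
  refine mul_le_of_le_one_right (abs_nonneg _) (abs_le.2 ⟨?_, ?_⟩) <;>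
    linarith [ha.1, ha.2, hb.1, hb.2]

lemma abs_mul_one_sub_le {a : ℝ} (ha : a ∈ Set.Icc (0 : ℝ) 1) : |a * (1 - a)| ≤ 1 := by
  rw [abs_le]
  constructor <;> nlinarith [ha.1, ha.2]

lemma abs_mul_mul_cas_le {a b : ℝ} (hb : |a| ≤ b) (k l : Fin d → ℤ) (y : Torus d) :
    |a * cas k y * cas l y| ≤ 4 * b := by
  rw [abs_mul, abs_mul]
  have h1 := abs_cas_le k y
  have h2 := abs_cas_le l y
  have h0 := (abs_nonneg a).trans hb
  calc _ ≤ b * 2 * 2 := by gcongr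
    _ = _ := by ring

lemma covForm_casL (ρ : Torus d → ℝ) (k l : Fin d → ℤ) :
    covForm ρ (casL k) (casL l) =
      ∫ y, ρ y * (1 - ρ y) * cas k y * cas l y ∂(torusMeasure d) := by
  refine integral_congr_ae ?_
  filter_upwards [casL_coeFn k, casL_coeFn l] with y h1 h2
  rw [h1, h2]

lemma abs_covForm_casL_le {ρ : Torus d → ℝ} (h01 : ∀ y, ρ y ∈ Set.Icc (0 : ℝ) 1)
    (k l : Fin d → ℤ) : |covForm ρ (casL k) (casL l)| ≤ 4 := by
  rw [covForm_casL]
  refine (norm_integral_le_of_norm_le_const (μ := torusMeasure d) (C := 4)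
    (f := fun y => ρ y * (1 - ρ y) * cas k y * cas l y) (.of_forall fun y => ?_)).trans ?_
  · exact (abs_mul_mul_cas_le (abs_mul_one_sub_le (h01 y)) k l y).trans (by norm_num)
  · simp

lemma one_le_sqrt_weight (k : Fin d → ℤ) : 1 ≤ √(weight k) := Real.one_le_sqrt.2 (one_le_weight k)

/-- The difference of products is telescoped over its three factors ρ(1-ρ), cas k and cas l. -/
lemma abs_prod_sub_le {ρ : Torus d → ℝ} (hρ : IsC1 ρ) (h01 : ∀ y, ρ y ∈ Set.Icc (0 : ℝ) 1)
    (k l : Fin d → ℤ) (s t : Fin d → ℝ) {h : ℝ} (hh : 0 ≤ h) (ht : ∀ j, |t j| ≤ h) :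
    |ρ (proj (s + t)) * (1 - ρ (proj (s + t))) * cas k (proj (s + t)) * cas l (proj (s + t)) -
      ρ (proj s) * (1 - ρ (proj s)) * cas k (proj s) * cas l (proj s)| ≤
      8 * (d * h) * (1 + gradNorm ρ) * (√(weight k) * √(weight l)) := by
  set p := proj (s + t)
  set q := proj s
  have hσ : |ρ p * (1 - ρ p) - ρ q * (1 - ρ q)| ≤ d * h * gradNorm ρ :=
    (abs_mul_one_sub_sub_le (h01 p) (h01 q)).trans (abs_proj_add_sub_le hρ s t hh ht)
  have hk := abs_cas_proj_add_sub_le k s t ht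
  have hl := abs_cas_proj_add_sub_le l s t ht
  have hG := gradNorm_nonneg ρ
  have e : ρ p * (1 - ρ p) * cas k p * cas l p - ρ q * (1 - ρ q) * cas k q * cas l q
      = (ρ p * (1 - ρ p) - ρ q * (1 - ρ q)) * cas k p * cas l p
        + (ρ q * (1 - ρ q) * (cas k p - cas k q) * cas l p
        + ρ q * (1 - ρ q) * cas k q * (cas l p - cas l q)) := by ring
  have h1 : |(ρ p * (1 - ρ p) - ρ q * (1 - ρ q)) * cas k p * cas l p|
      ≤ 4 * (d * h * gradNorm ρ) := abs_mul_mul_cas_le hσ k l p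
  have h2 : |ρ q * (1 - ρ q) * (cas k p - cas k q) * cas l p| ≤
      1 * (2 * (d * h) * √(weight k)) * 2 := by
    rw [abs_mul, abs_mul]
    gcongr
    · exact abs_mul_one_sub_le (h01 q)
    · exact abs_cas_le l p
  have h3 : |ρ q * (1 - ρ q) * cas k q * (cas l p - cas l q)| ≤
      1 * 2 * (2 * (d * h) * √(weight l)) := by
    rw [abs_mul, abs_mul]
    gcongr
    · exact abs_mul_one_sub_le (h01 q)
    · exact abs_cas_le k q
  have ha := one_le_sqrt_weight k
  have hb := one_le_sqrt_weight l
  set a := √(weight k)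
  set b := √(weight l)
  -- Since a, b ≥ 1, the sum is absorbed into a multiple of a · b; the product form is what later
  -- yields a rank one kernel.
  have hab : gradNorm ρ + a + b ≤ 2 * (1 + gradNorm ρ) * (a * b) := by
    nlinarith [mul_nonneg (sub_nonneg.2 ha) (sub_nonneg.2 hb), mul_nonneg hG
      (by nlinarith : 0 ≤ a * b - 1)]
  have hdh : 0 ≤ d * h := by positivity
  rw [e]
  calc _ ≤ 4 * (d * h * gradNorm ρ) + (1 * (2 * (d * h) * a) * 2 + 1 * 2 * (2 * (d * h) * b)) :=
        (abs_add_le _ _).trans (add_le_add h1 ((abs_add_le _ _).trans (add_le_add h2 h3)))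
    _ = 4 * (d * h) * (gradNorm ρ + a + b) := by ring
    _ ≤ 4 * (d * h) * (2 * (1 + gradNorm ρ) * (a * b)) := by gcongr
    _ = _ := by ring

/-- First `r` is replaced by ρ on the grid, at a cost of order the discrete norm; then the Riemann
sum is replaced by the integral. -/
lemma abs_discCov_sub_covForm_le {ρ : Torus d → ℝ} (hρ : IsC1 ρ)
    (h01 : ∀ y, ρ y ∈ Set.Icc (0 : ℝ) 1) (hn : 1 ≤ n) (r : Idx d n → unitInterval)
    (k l : Fin d → ℤ) :
    |((2 * n + 1 : ℝ) ^ d)⁻¹ * ∑ x, (r x : ℝ) * (1 - r x) * cas k (site x) * cas l (site x) -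
      covForm ρ (casL k) (casL l)| ≤
      (4 * (discNorm fun x => (r x : ℝ) - ρ (site x)) + 16 * d * ((1 + gradNorm ρ) / n)) *
        (√(weight k) * √(weight l)) := by
  have hn0 : (0 : ℝ) < n := by exact_mod_cast hn
  have hG := gradNorm_nonneg ρ
  have hcont := hρ.continuous
  have h1 : |((2 * n + 1 : ℝ) ^ d)⁻¹ * ∑ x, (r x : ℝ) * (1 - r x) * cas k (site x) *
      cas l (site x) - ((2 * n + 1 : ℝ) ^ d)⁻¹ * ∑ x : Idx d n, ρ (site x) * (1 - ρ (site x)) *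
      cas k (site x) * cas l (site x)| ≤ 4 * discNorm fun x => (r x : ℝ) - ρ (site x) := by
    rw [← mul_sub, ← Finset.sum_sub_distrib, abs_mul, abs_of_pos (by positivity)]
    calc _ ≤ ((2 * n + 1 : ℝ) ^ d)⁻¹ * ∑ x, 4 * |(r x : ℝ) - ρ (site x)| := by
          gcongr
          refine (Finset.abs_sum_le_sum_abs _ _).trans (Finset.sum_le_sum fun x _ => ?_)
          rw [← sub_mul, ← sub_mul]
          exact abs_mul_mul_cas_le (abs_mul_one_sub_sub_le (r x).2 (h01 _)) k l _
      _ = 4 * (((2 * n + 1 : ℝ) ^ d)⁻¹ * ∑ x, |(r x : ℝ) - ρ (site x)|) := by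
          rw [← Finset.mul_sum]; ring
      _ ≤ _ := by gcongr; exact discNorm_bound _
  have h2 := abs_riemannSum_sub_integral_le (n := n)
    (g := fun y => ρ y * (1 - ρ y) * cas k y * cas l y) (by fun_prop)
    (fun s t ht => abs_prod_sub_le hρ h01 k l s t (by positivity) ht)
  rw [← covForm_casL] at h2
  have hpi : Real.pi / (2 * n + 1) ≤ 2 / n := by
    rw [div_le_div_iff₀ (by positivity) hn0]
    nlinarith [Real.pi_le_four]
  have ha := one_le_sqrt_weight k
  have hb := one_le_sqrt_weight l
  set a := √(weight k)
  set b := √(weight l)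
  have hab : 1 ≤ a * b := one_le_mul_of_one_le_of_one_le ha hb
  have hD : 0 ≤ discNorm fun x => (r x : ℝ) - ρ (site x) := Real.sqrt_nonneg _
  refine (abs_sub_le _ _ _).trans ((add_le_add h1 h2).trans ?_)
  rw [add_mul]
  refine add_le_add (le_mul_of_one_le_right (by positivity) hab) ?_
  calc _ ≤ 8 * (d * (2 / n)) * (1 + gradNorm ρ) * (a * b) := by gcongr
    _ = _ := by ring

end Extension

/-! ### Covariance difference in the basis of H_{-J}, Bernoulli moments and explicit rates. -/

section Rates

variable {d n : ℕ}

lemma sum_inner_siteVec (J : ℝ≥0) (r : Idx d n → ℝ) (k l : Idx d n) :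
    ∑ x, r x * (inner ℝ (negBasis J (freq k)) (siteVec J x) *
      inner ℝ (negBasis J (freq l)) (siteVec J x)) =
    weight (freq k) ^ (-((J : ℝ) / 2)) * weight (freq l) ^ (-((J : ℝ) / 2)) *
      (((2 * n + 1 : ℝ) ^ d)⁻¹ * ∑ x, r x * cas (freq k) (site x) * cas (freq l) (site x)) := by
  have hc0 : (2 * n + 1 : ℝ) ^ ((d : ℝ) / 2) ≠ 0 := rpow_half_pos.ne'
  simp only [inner_negBasis_siteVec, ← rpow_half_sq (d := d) (n := n)]
  rw [Finset.mul_sum, Finset.mul_sum]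
  refine Finset.sum_congr rfl fun x _ => ?_
  field_simp

/-- The sequence controlling the difference of the covariances in the basis `negBasis`. -/
def covBound (J : ℝ≥0) (D : ℝ) (k : Fin d → ℤ) : ℝ := √D * weight k ^ (-(((J : ℝ) - 1) / 2))

lemma covBound_sq (J : ℝ≥0) {D : ℝ} (hD : 0 ≤ D) (k : Fin d → ℤ) :
    covBound J D k ^ 2 = D * weight k ^ (-((J : ℝ) - 1)) := by
  rw [covBound, mul_pow, Real.sq_sqrt hD, weight_rpow_half_sq]

/-- Each of the two indices loses a factor √weight to the Riemann sum error, which lowers the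
exponent from J/2 to (J-1)/2. -/
lemma covBound_mul (J : ℝ≥0) {D : ℝ} (hD : 0 ≤ D) (k l : Fin d → ℤ) :
    covBound J D k * covBound J D l =
      weight k ^ (-((J : ℝ) / 2)) * weight l ^ (-((J : ℝ) / 2)) *
        (D * (√(weight k) * √(weight l))) := by
  have h : ∀ m : Fin d → ℤ, weight m ^ (-(((J : ℝ) - 1) / 2))
      = weight m ^ (-((J : ℝ) / 2)) * √(weight m) := fun m => by
    rw [Real.sqrt_eq_rpow, ← Real.rpow_add (weight_pos m)]
    congr 1
    ring
  rw [covBound, covBound, h, h]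
  linear_combination (weight k ^ (-((J : ℝ) / 2)) * √(weight k) * (weight l ^ (-((J : ℝ) / 2)) *
    √(weight l))) * Real.mul_self_sqrt hD

lemma integral_inner_negBasis {J : ℝ≥0} {ρ : Torus d → ℝ} {Ω : Type*} [MeasurableSpace Ω]
    {P : Measure Ω} {ζ : Ω → NegSobolev d J} (hζ : IsCenteredGaussian ζ ρ P) (k l : Fin d → ℤ) :
    ∫ z, inner ℝ (negBasis J k) z * inner ℝ (negBasis J l) z ∂(P.map ζ) =
      weight k ^ (-((J : ℝ) / 2)) * weight l ^ (-((J : ℝ) / 2)) *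
        covForm ρ (casL k) (casL l) := by
  rw [integral_map hζ.gaussian.aemeasurable (by fun_prop),
    ← hζ.covariance _ _ (memSobolev_casL J k) (memSobolev_casL J l), ← integral_const_mul]
  refine integral_congr_ae (.of_forall fun ω => ?_)
  simp only [inner_negBasis]
  ring

/-- The rate `‖ρ_n - ρ‖_n + n⁻¹ (1 + ‖∇ρ‖)` at which the covariances converge. -/
def covRate (ρ : Torus d → ℝ) (r : Idx d n → unitInterval) : ℝ :=
  4 * (discNorm fun x => (r x : ℝ) - ρ (site x)) + (16 * d + 4) * ((1 + gradNorm ρ) / n)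

lemma covRate_nonneg (ρ : Torus d → ℝ) (r : Idx d n → unitInterval) : 0 ≤ covRate ρ r := by
  have := gradNorm_nonneg ρ
  have : 0 ≤ discNorm fun x => (r x : ℝ) - ρ (site x) := Real.sqrt_nonneg _
  unfold covRate
  positivity

/-- If k or l is cut off, the covariance entry is only bounded by 4, but then the product of the
square roots of the weights is at least n. The summand 4 in the coefficient 16d + 4 of `covRate`
pays for this. -/
lemma four_le_covRate_mul {ρ : Torus d → ℝ} (hn : 1 ≤ n) (r : Idx d n → unitInterval)
    {a b : ℝ} (ha : 1 ≤ a) (hb : 1 ≤ b) (h : (n : ℝ) ≤ a ∨ (n : ℝ) ≤ b) :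
    4 ≤ covRate ρ r * (a * b) := by
  have hn0 : (0 : ℝ) < n := by exact_mod_cast hn
  have hG := gradNorm_nonneg ρ
  have hab : (n : ℝ) ≤ a * b := by
    rcases h with h | h
    · exact h.trans (le_mul_of_one_le_right (by linarith) hb)
    · exact h.trans (le_mul_of_one_le_left (by linarith) ha)
  have hD : 0 ≤ discNorm fun x => (r x : ℝ) - ρ (site x) := Real.sqrt_nonneg _
  have h1 : 4 / n ≤ covRate ρ r := by
    unfold covRate
    have h2 : 4 * (1 / n : ℝ) ≤ (16 * d + 4) * ((1 + gradNorm ρ) / n) := by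
      gcongr
      · linarith [(by positivity : (0 : ℝ) ≤ 16 * d)]
      · linarith
    linarith [mul_one_div (4 : ℝ) n]
  calc (4 : ℝ) = 4 / n * n := by field_simp
    _ ≤ _ := by
      gcongr
      exact covRate_nonneg ρ r

lemma abs_covariance_sub_le {J : ℝ≥0} {ρ : Torus d → ℝ} (hρ : IsC1 ρ)
    (h01 : ∀ y, ρ y ∈ Set.Icc (0 : ℝ) 1) {Ω : Type*} [MeasurableSpace Ω] {P : Measure Ω}
    {ζ : Ω → NegSobolev d J} (hζ : IsCenteredGaussian ζ ρ P) (hn : 1 ≤ n)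
    (r : Idx d n → unitInterval) (k l : Fin d → ℤ) :
    |∑ x, (r x : ℝ) * (1 - r x) * (inner ℝ (negBasis J k) (siteVec J x) *
      inner ℝ (negBasis J l) (siteVec J x)) -
      ∫ z, inner ℝ (negBasis J k) z * inner ℝ (negBasis J l) z ∂(P.map ζ)| ≤
      covBound J (covRate ρ r) k * covBound J (covRate ρ r) l := by
  have hw : ∀ m : Fin d → ℤ, 0 ≤ weight m ^ (-((J : ℝ) / 2)) := fun m =>
    Real.rpow_nonneg (weight_pos m).le _
  rw [integral_inner_negBasis hζ, covBound_mul J (covRate_nonneg ρ r)]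
  -- With both frequencies in the box the Riemann sum estimate applies. Otherwise the discrete
  -- covariance entry is zero and only that of ζ has to be bounded.
  by_cases h : k ∈ Set.range (freq (d := d) (n := n)) ∧ l ∈ Set.range (freq (d := d) (n := n))
  · obtain ⟨⟨k, rfl⟩, ⟨l, rfl⟩⟩ := h
    rw [sum_inner_siteVec J (fun x => (r x : ℝ) * (1 - r x)), ← mul_sub, abs_mul,
      abs_of_nonneg (mul_nonneg (hw _) (hw _))]
    refine mul_le_mul_of_nonneg_left ((abs_discCov_sub_covForm_le hρ h01 hn r _ _).trans ?_)
      (mul_nonneg (hw _) (hw _))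
    refine mul_le_mul_of_nonneg_right ?_ (by positivity)
    unfold covRate
    have := gradNorm_nonneg ρ
    gcongr
    linarith
  · have h0 : ∀ x : Idx d n, (r x : ℝ) * (1 - r x) * (inner ℝ (negBasis J k) (siteVec J x) *
        inner ℝ (negBasis J l) (siteVec J x)) = 0 := fun x => by
      rcases not_and_or.1 h with h | h
      · rw [inner_negBasis_siteVec_of_notMem J x h]; ring
      · rw [inner_negBasis_siteVec_of_notMem J x h]; ring
    rw [Finset.sum_eq_zero fun x _ => h0 x, zero_sub, abs_neg, abs_mul,
      abs_of_nonneg (mul_nonneg (hw _) (hw _))]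
    refine mul_le_mul_of_nonneg_left ((abs_covForm_casL_le h01 k l).trans ?_)
      (mul_nonneg (hw _) (hw _))
    exact four_le_covRate_mul hn r (one_le_sqrt_weight k) (one_le_sqrt_weight l)
      ((not_and_or.1 h).imp sq_le_weight_of_notMem sq_le_weight_of_notMem)

/-! ### Bernoulli occupation variables -/

instance (r : Idx d n → unitInterval) : IsProbabilityMeasure (productBernoulli r) := by
  unfold productBernoulli; infer_instance

/-- The centered occupation variable at a site. -/
def centeredOcc (r : Idx d n → unitInterval) (x : Idx d n) (η : Idx d n → Bool) : ℝ :=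
  (if η x then 1 else 0) - (r x : ℝ)

lemma iIndepFun_centeredOcc (r : Idx d n → unitInterval) :
    iIndepFun (centeredOcc r) (productBernoulli r) :=
  iIndepFun_pi (X := fun x (b : Bool) => (if b then 1 else 0) - (r x : ℝ))
    fun _ => (measurable_of_finite _).aemeasurable

lemma measurable_centeredOcc (r : Idx d n → unitInterval) (x : Idx d n) :
    Measurable (centeredOcc r x) :=
  (measurable_of_finite fun b : Bool => (if b then 1 else 0) - (r x : ℝ)).comp
    (measurable_pi_apply x)

lemma abs_centeredOcc_le (r : Idx d n → unitInterval) (x : Idx d n) (η : Idx d n → Bool) :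
    |centeredOcc r x η| ≤ 1 := by
  have h := (r x).2
  rw [centeredOcc, abs_le]
  split_ifs <;> constructor <;> linarith [h.1, h.2]

lemma integral_comp_centeredOcc (r : Idx d n → unitInterval) (x : Idx d n) (g : ℝ → ℝ) :
    ∫ η, g (centeredOcc r x η) ∂(productBernoulli r) =
      r x * g (1 - r x) + (1 - r x) * g (-r x) := by
  have h := (measurePreserving_eval (fun x => bernoulliMeasure true false (r x)) x).map_eq
  have h2 := integral_bernoulliMeasure true false (r x)
    fun b : Bool => g ((if b then 1 else 0) - (r x : ℝ))
  rw [← h, integral_map (measurable_pi_apply x).aemeasurable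
    (measurable_of_finite _).aestronglyMeasurable] at h2
  simpa [centeredOcc, productBernoulli] using h2

lemma integral_centeredOcc (r : Idx d n → unitInterval) (x : Idx d n) :
    ∫ η, centeredOcc r x η ∂(productBernoulli r) = 0 := by
  rw [integral_comp_centeredOcc r x fun t => t]
  ring

lemma integral_sq_centeredOcc (r : Idx d n → unitInterval) (x : Idx d n) :
    ∫ η, centeredOcc r x η ^ 2 ∂(productBernoulli r) = r x * (1 - r x) := by
  rw [integral_comp_centeredOcc r x fun t => t ^ 2]
  ring

lemma exNeg_fluctuation_eq (J : ℝ≥0) (r : Idx d n → unitInterval) :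
    (fun η => exNeg J (fluctuation r η)) = ∑ x, fun η => centeredOcc r x η • siteVec J x := by
  ext1 η
  rw [exNeg_fluctuation, Finset.sum_apply]
  rfl

/-! ### The error terms -/

/-- With c = (2n+1)^{d/2} there are c² sites, each contributing O(c^{-3}), and c ≥ n^{d/2}. -/
lemma sum_norm_siteVec_pow_le {J : ℝ≥0} (hJ : (d : ℝ) / 2 < J) (hn : 1 ≤ n) :
    ∑ x : Idx d n, ‖siteVec J x‖ ^ 3 ≤
      (2 * √(∑' k : Fin d → ℤ, weight k ^ (-(J : ℝ)))) ^ 3 * (1 / (n : ℝ) ^ (min 1 ((d : ℝ) / 2))) := by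
  set A := 2 * √(∑' k : Fin d → ℤ, weight k ^ (-(J : ℝ))) with hA
  set c := (2 * n + 1 : ℝ) ^ ((d : ℝ) / 2) with hc
  have hA0 : 0 ≤ A := by positivity
  have hc0 : 0 < c := rpow_half_pos
  have hn1 : (1 : ℝ) ≤ n := by exact_mod_cast hn
  have hcn : (n : ℝ) ^ (min 1 ((d : ℝ) / 2)) ≤ c :=
    (Real.rpow_le_rpow_of_exponent_le hn1 (min_le_right _ _)).trans
      (Real.rpow_le_rpow (by linarith) (by linarith) (by positivity))
  calc ∑ x : Idx d n, ‖siteVec J x‖ ^ 3 ≤ ∑ _x : Idx d n, (A / c) ^ 3 :=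
        Finset.sum_le_sum fun x _ => pow_le_pow_left₀ (norm_nonneg _) (norm_siteVec_le hJ x) 3
    _ = A ^ 3 * (1 / c) := by
        rw [Finset.sum_const, Finset.card_univ, nsmul_eq_mul, card_idx, ← rpow_half_sq, ← hc]
        field_simp
    _ ≤ _ := by gcongr

lemma covRate_le {ρ : Torus d → ℝ} (hn : 1 ≤ n) (r : Idx d n → unitInterval) :
    covRate ρ r ≤ (16 * d + 4) * (1 / (n : ℝ) ^ (min 1 ((d : ℝ) / 2)) * (1 + gradNorm ρ) +
      discNorm fun x => (r x : ℝ) - ρ (site x)) := by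
  have hn1 : (1 : ℝ) ≤ n := by exact_mod_cast hn
  have hG := gradNorm_nonneg ρ
  have hD : 0 ≤ discNorm fun x => (r x : ℝ) - ρ (site x) := Real.sqrt_nonneg _
  have h1 : (n : ℝ) ^ (min 1 ((d : ℝ) / 2)) ≤ n := by
    simpa using Real.rpow_le_rpow_of_exponent_le hn1 (min_le_left 1 ((d : ℝ) / 2))
  have h0 : 0 < (n : ℝ) ^ (min 1 ((d : ℝ) / 2)) := by positivity
  have h2 : (1 + gradNorm ρ) / n ≤ 1 / (n : ℝ) ^ (min 1 ((d : ℝ) / 2)) * (1 + gradNorm ρ) := by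
    rw [div_eq_inv_mul, ← one_div]
    gcongr
  unfold covRate
  rw [mul_add, add_comm]
  gcongr
  linarith [(by positivity : (0 : ℝ) ≤ 16 * d)]

/-- The constant in the Berry-Esseen bound. -/
def berryEsseenConst (d : ℕ) (J : ℝ≥0) : ℝ :=
  (1 + gaussThird) / 2 * (2 * √(∑' k : Fin d → ℤ, weight k ^ (-(J : ℝ)))) ^ 3 +
    (16 * d + 4) * (∑' k : Fin d → ℤ, weight k ^ (-((J : ℝ) - 1))) / 2

end Rates

end SSEP

end

/-! ### Assembly of the bound. -/

theorem mainTheorem3 (d : ℕ) (hd : 1 ≤ d) (I : ℝ≥0) (hI : (d : ℝ) / 2 + 1 < I) :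
    ∃ C : ℝ, ∀ (ρ : SSEP.Torus d → ℝ), SSEP.IsC1 ρ → (∀ x, ρ x ∈ Set.Icc (0 : ℝ) 1) →
      ∀ (Ω : Type*) [MeasurableSpace Ω] (P : Measure Ω) [IsProbabilityMeasure P]
        (ζ : Ω → SSEP.NegSobolev d I), SSEP.IsCenteredGaussian ζ ρ P →
      ∀ (n : ℕ), 1 ≤ n → ∀ (ρn : SSEP.Idx d n → unitInterval)
        (Ω' : Type*) [MeasurableSpace Ω'] (P' : Measure Ω') [IsProbabilityMeasure P']
        (η : Ω' → SSEP.Idx d n → Bool), HasLaw η (SSEP.productBernoulli ρn) P' →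
      ∀ (F : SSEP.NegSobolev d I → ℝ), SSEP.MemClHS 3 F →
        Integrable (fun ω => F (ζ ω)) P ∧
        Integrable (fun ω => F (SSEP.exNeg I (SSEP.fluctuation ρn (η ω)))) P' ∧
        |∫ ω, F (SSEP.exNeg I (SSEP.fluctuation ρn (η ω))) ∂P' - ∫ ω, F (ζ ω) ∂P| ≤
          C * (1 / (n : ℝ) ^ (min 1 ((d : ℝ) / 2)) * (1 + SSEP.gradNorm ρ) +
            SSEP.discNorm fun x => (ρn x : ℝ) - ρ (SSEP.site x)) * SSEP.clHSNorm 3 F := by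
  refine ⟨SSEP.berryEsseenConst d I, ?_⟩
  intro ρ hρ h01 Ω _ P _ ζ hζ n hn r Ω' _ P' _ η hη F hF
  have hL := hF.lipschitzWith (by norm_num)
  have hc : Continuous F := hL.continuous
  have hζm := hζ.gaussian.aemeasurable
  have hγ : IsGaussian (P.map ζ) := hζ.gaussian.isGaussian_map
  have hγ0 : ∫ z, z ∂(P.map ζ) = 0 := by
    rw [integral_map hζm (by fun_prop), hζ.centered]
  -- F is Lipschitz and a Gaussian measure has a finite first moment.
  have hi : Integrable (fun ω => F (ζ ω)) P := by
    have h := SSEP.integrable_comp_add hL (IsGaussian.integrable_id (μ := P.map ζ)) 0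
    simp only [zero_add] at h
    exact (integrable_map_measure hc.aestronglyMeasurable hζm).1 h
  have hX : Measurable fun η : SSEP.Idx d n → Bool => SSEP.exNeg I (SSEP.fluctuation r η) :=
    measurable_of_finite _
  have hFX : Measurable fun η : SSEP.Idx d n → Bool => F (SSEP.exNeg I (SSEP.fluctuation r η)) :=
    measurable_of_finite _
  have hi' : Integrable (fun ω => F (SSEP.exNeg I (SSEP.fluctuation r (η ω)))) P' := by
    have h : Integrable (fun η : SSEP.Idx d n → Bool =>
        F (SSEP.exNeg I (SSEP.fluctuation r η))) (SSEP.productBernoulli r) := .of_finite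
    rw [← hη.map_eq] at h
    exact (integrable_map_measure hFX.aestronglyMeasurable hη.aemeasurable).1 h
  refine ⟨hi, hi', ?_⟩
  -- The full strength of I > d/2 + 1 enters here; the bound on `siteVec` only needs I > d/2.
  have hs := SSEP.summable_weight_rpow (d := d) (s := (I : ℝ) - 1) (by linarith)
  have hD := SSEP.covRate_nonneg ρ r
  have key := SSEP.TranslateClose.berryEsseen hF (SSEP.iIndepFun_centeredOcc r)
    (SSEP.measurable_centeredOcc r) (SSEP.abs_centeredOcc_le r) (SSEP.integral_centeredOcc r)
    (SSEP.siteVec I) hγ0 (SSEP.negBasis I) (a := SSEP.covBound I (SSEP.covRate ρ r))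
    (by simpa only [SSEP.covBound_sq I hD] using hs.mul_left _)
    (by
      simp only [SSEP.integral_sq_centeredOcc]
      exact SSEP.abs_covariance_sub_le hρ h01 hζ hn r) 0
  rw [← SSEP.exNeg_fluctuation_eq] at key
  simp only [zero_add, SSEP.covBound_sq I hD] at key
  rw [tsum_mul_left, integral_map hX.aemeasurable hc.aestronglyMeasurable,
    integral_map hζm hc.aestronglyMeasurable] at key
  have e : ∫ ω, F (SSEP.exNeg I (SSEP.fluctuation r (η ω))) ∂P' =
      ∫ η, F (SSEP.exNeg I (SSEP.fluctuation r η)) ∂(SSEP.productBernoulli r) := by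
    rw [← hη.map_eq, integral_map hη.aemeasurable hFX.aestronglyMeasurable]
  rw [e]
  refine key.trans ?_
  have hK := SSEP.clHSNorm_nonneg 3 F
  have hG := SSEP.gradNorm_nonneg ρ
  have hN : 0 ≤ SSEP.discNorm fun x => (r x : ℝ) - ρ (SSEP.site x) := Real.sqrt_nonneg _
  have hm : 0 ≤ SSEP.gaussThird := integral_nonneg fun t => pow_nonneg (abs_nonneg _) 3
  have hW : 0 ≤ ∑' k : Fin d → ℤ, SSEP.weight k ^ (-((I : ℝ) - 1)) :=
    tsum_nonneg fun k => Real.rpow_nonneg (SSEP.weight_pos k).le _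
  have h1 := SSEP.sum_norm_siteVec_pow_le (d := d) (J := I) (by linarith) hn
  have h2 := SSEP.covRate_le (ρ := ρ) hn r
  set δ := 1 / (n : ℝ) ^ (min 1 ((d : ℝ) / 2)) with hδ
  set A := 2 * √(∑' k : Fin d → ℤ, SSEP.weight k ^ (-(I : ℝ))) with hA
  have hδ0 : 0 ≤ δ := by positivity
  have hA0 : 0 ≤ A := by positivity
  set ε := δ * (1 + SSEP.gradNorm ρ) + SSEP.discNorm fun x => (r x : ℝ) - ρ (SSEP.site x) with hε
  -- The Lindeberg error carries no gradient; it is absorbed because 1 ≤ 1 + ‖∇ρ‖.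
  have hδε : δ ≤ ε := by
    rw [hε]
    nlinarith [mul_nonneg hδ0 hG]
  rw [mul_comm (SSEP.berryEsseenConst d I * ε)]
  refine mul_le_mul_of_nonneg_left ?_ hK
  calc _ ≤ (1 + SSEP.gaussThird) / 2 * (A ^ 3 * ε) + (16 * d + 4) * ε *
        (∑' k : Fin d → ℤ, SSEP.weight k ^ (-((I : ℝ) - 1))) / 2 := by
        gcongr
        exact h1.trans (by gcongr)
    _ = _ := by
      rw [SSEP.berryEsseenConst, ← hA]
      ring
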